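/- **Setting.** Let $\Delta=2^l$ with $l\ge 0$, let $n=\Delta^2$, and identify $\mathbb R^n$ with $\mathbb R^{[\Delta]^2}$ (images of $\Delta\times\Delta$ pixels). For $x,y\ge 0$ in $\mathbb R^n$ with $\|x\|_1=\|y\|_1$ let $\mathrm{EMD}^*(x,y)$ be the minimum of $\sum_{i,j}\gamma(i,j)\|i-j\|_1$ over all $\gamma\ge 0$ with $\sum_j\gamma(i,j)=x_i$ and $\sum_i\gamma(i,j)=y_j$. For $w\in\mathbb R^n$ let $$\|w\|_{EMD}=\min\{\mathrm{EMD}^*(x,y)+2\Delta\|z\|_1 \;:\; x-y+z=w,\ x,y\ge 0,\ \|x\|_1=\|y\|_1\}.$$ A vector is $k$-sparse if it has at most $k$ nonzero coordinates. For $1\le i\le l$ partition the image into dyadic cells of side $2^i$ (the cells of level $i$). Let $H\in\mathbb R^{n\times n}$ be the orthonormal non-standard two-dimensional Haar transform. It has one constant row with entries $1/\Delta$. For each cell of each level $i\ge1$ it has three rows, which vanish outside the cell and have entries $\pm2^{-i}$ inside it: $+$ on the left half and $-$ on the right half; $+$ on the top half and $-$ on the bottom half; $+$ on the top-left and bottom-right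 quadrants and $-$ on the other two. Let $W$ be obtained from $H$ by multiplying the rows of level $i$ by $2^{2i-2}$ and the constant row by $2\Delta^2$, so that every column of $W^{-1}$ has EMD norm $1$. The rows of $W$ form a tree. Its root is the constant row, the children of the root are the three rows of the level-$l$ cell, and the children of any other row, belonging to a cell $c$ of level $i\ge 2$, are the rows of the same orientation belonging to the four level-$(i-1)$ cells contained in $c$. Let $\mathcal T_K$ be the set of vectors $y\in\mathbb R^n$, indexed by the rows of $W$, whose support is contained in a connected set of at most $K$ vertices of this tree that contains the root. **Theorem.** There are absolute constants $c,c_1,C_0>0$ such that the following holds for all $l$ and all integers $k$ with $1\le k<n/2$. Put $K=\lceil c\,k\log(n/k)\rceil$. There are a matrix $A$ with $n$ columns and at most $c_1k\log(n/k)$ rows, a number $C$ with $0<C\le C_0\sqrt{\log(n/k)}$, and a recovery procedure (a map from the sketch $Ax$ to a vector $x^*\in\mathbb R^n$) such that $$\|x^*-x\|_{EMD}\;\le\; C\min_{y\in\mathcal T_K}\|Wx-y\|_1\qquad\text{for every }x\in\mathbb R^n,$$ and, for every $x\in\mathbb R^n$ with $x\ge 0$, $$C\min_{y\in\mathcal T_K}\|Wx-y\|_1\;\le\;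 C\min_{k\text{-sparse }x'}\|x-x'\|_{EMD}.$$ -/

import Mathlib

/-- The pixels of a `Δ × Δ` image with `Δ = 2 ^ l`; there are `n = 4 ^ l` of them. The first
coordinate runs from left to right, the second from top to bottom. -/
abbrev Pixel (l : ℕ) : Type := Fin (2 ^ l) × Fin (2 ^ l)

/-- The `ℓ₁` norm of a vector. -/
noncomputable def l1Norm {ι : Type*} [Fintype ι] (x : ι → ℝ) : ℝ := ∑ i, |x i|

/-- The `ℓ₁` distance between two pixels. -/
noncomputable def pixelDist {l : ℕ} (p q : Pixel l) : ℝ :=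
  |(p.1.val : ℝ) - (q.1.val : ℝ)| + |(p.2.val : ℝ) - (q.2.val : ℝ)|

/-- The flows from `x` to `y`. -/
def flows {l : ℕ} (x y : Pixel l → ℝ) : Set (Pixel l → Pixel l → ℝ) :=
  {γ | (∀ i j, 0 ≤ γ i j) ∧ (∀ i, ∑ j, γ i j = x i) ∧ (∀ j, ∑ i, γ i j = y j)}

/-- The cost of a flow. -/
noncomputable def flowCost {l : ℕ} (γ : Pixel l → Pixel l → ℝ) : ℝ :=
  ∑ i, ∑ j, γ i j * pixelDist i j

/-- The min-cost flow from `x` to `y`; used only for `x, y ≥ 0` of equal mass, where flows exist. -/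
noncomputable def emdStar {l : ℕ} (x y : Pixel l → ℝ) : ℝ :=
  sInf (flowCost '' flows x y)

/-- The Earth-Mover norm of a vector: min-cost flow from its positive to its negative part, where
unmatched mass is charged the diameter `2 Δ`. -/
noncomputable def emdNorm {l : ℕ} (w : Pixel l → ℝ) : ℝ :=
  sInf {r : ℝ | ∃ x y z : Pixel l → ℝ, x - y + z = w ∧ l1Norm x = l1Norm y ∧ 0 ≤ x ∧ 0 ≤ y ∧
    r = emdStar x y + 2 * 2 ^ l * l1Norm z}

/-- The vectors with at most `k` nonzero coordinates. -/
def sparseVectors (l k : ℕ) : Set (Pixel l → ℝ) :=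
  {x | (Function.support x).ncard ≤ k}

/-- The index of a non-constant Haar wavelet: a grid cell and one of three orientations.
A cell of depth `j < l` has side length `2 ^ (l - j)`, so it is at level `i = l - j ≥ 1` of the
nested dyadic grids; it is the cell in column `a` and row `b` of the `2 ^ j × 2 ^ j` grid. -/
abbrev DetailIndex (l : ℕ) : Type :=
  Σ j : Fin l, (Fin (2 ^ j.val) × Fin (2 ^ j.val)) × Fin 3

/-- The level `i = l - j` of a wavelet; its cell has side length `2 ^ i`. -/
def DetailIndex.level {l : ℕ} (d : DetailIndex l) : ℕ := l - d.1.val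

/-- The column of the cell of a wavelet. -/
def DetailIndex.col {l : ℕ} (d : DetailIndex l) : ℕ := d.2.1.1.val

/-- The row of the cell of a wavelet. -/
def DetailIndex.row {l : ℕ} (d : DetailIndex l) : ℕ := d.2.1.2.val

/-- The orientation of a wavelet: `0` for left/right, `1` for top/bottom, `2` for diagonal. -/
def DetailIndex.orient {l : ℕ} (d : DetailIndex l) : Fin 3 := d.2.2

/-- The pixel `p` lies in the cell of the wavelet `d`. -/
def DetailIndex.Covers {l : ℕ} (d : DetailIndex l) (p : Pixel l) : Prop :=
  p.1.val / 2 ^ d.level = d.col ∧ p.2.val / 2 ^ d.level = d.row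

/-- The sign of the wavelet `d` at a pixel of its cell. The parity of `p.1 / 2 ^ (i - 1)` tells the
left half of a level `i` cell (even) from its right half (odd); likewise for top and bottom. -/
noncomputable def DetailIndex.sign {l : ℕ} (d : DetailIndex l) (p : Pixel l) : ℝ :=
  let u := p.1.val / 2 ^ (d.level - 1)
  let v := p.2.val / 2 ^ (d.level - 1)
  if d.orient = 0 then (-1) ^ u else if d.orient = 1 then (-1) ^ v else (-1) ^ (u + v)

/-- The index set of the Haar basis: `none` is the constant vector. -/
abbrev WaveletIndex (l : ℕ) : Type := Option (DetailIndex l)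

open Classical in
/-- The orthonormal (non-standard) two-dimensional Haar transform: the entries of the constant row
are `1 / Δ`, the nonzero entries of a row of level `i` are `± 2 ^ (-i)`. -/
noncomputable def haarMatrix (l : ℕ) : Matrix (WaveletIndex l) (Pixel l) ℝ
  | none, _ => ((2 : ℝ) ^ l)⁻¹
  | some d, p => if d.Covers p then d.sign p * ((2 : ℝ) ^ d.level)⁻¹ else 0

/-- The factors by which the rows of the Haar transform are rescaled: `2 ^ (2 i - 2)` at level `i`,
and `2 Δ ^ 2` for the constant row. With them every column of the inverse of the rescaled transform
has Earth-Mover norm one. -/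
noncomputable def haarScale (l : ℕ) : WaveletIndex l → ℝ
  | none => 2 * 4 ^ l
  | some d => 4 ^ d.level / 4

/-- The rescaled Haar transform `W`. -/
noncomputable def rescaledHaar (l : ℕ) : Matrix (WaveletIndex l) (Pixel l) ℝ :=
  Matrix.diagonal (haarScale l) * haarMatrix l

/-- `IsParent p q`: in the tree of wavelet coefficients, `p` is the parent of `q`. The root is the
constant vector, its children are the three wavelets of the whole image, and the children of any
other wavelet are those of the same orientation on the four quadrants of its cell. -/
def IsParent {l : ℕ} : WaveletIndex l → WaveletIndex l → Prop
  | _, none => False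
  | none, some d => d.1.val = 0
  | some e, some d => d.1.val = e.1.val + 1 ∧ e.col = d.col / 2 ∧ e.row = d.row / 2 ∧
      e.orient = d.orient

/-- The vertex sets of the subtrees that contain the root, i.e. the sets that contain the root and
with every vertex also its parent. -/
def IsRootedSubtree {l : ℕ} (S : Finset (WaveletIndex l)) : Prop :=
  none ∈ S ∧ ∀ p q, IsParent p q → q ∈ S → p ∈ S

/-- The tree-sparse model `𝒯_K`: the vectors supported on a rooted subtree with at most `K`
vertices. -/
def treeSparse (l K : ℕ) : Set (WaveletIndex l → ℝ) :=
  {y | ∃ S : Finset (WaveletIndex l), IsRootedSubtree S ∧ S.card ≤ K ∧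
    Function.support y ⊆ (S : Set (WaveletIndex l))}

/-- The error of the best tree-sparse approximation of the rescaled Haar transform of `x`, in the
`ℓ₁` norm. -/
noncomputable def treeError {l : ℕ} (K : ℕ) (x : Pixel l → ℝ) : ℝ :=
  sInf ((fun y => l1Norm ((rescaledHaar l).mulVec x - y)) '' treeSparse l K)

/-- The error of the best `k`-sparse approximation of `x`, in the Earth-Mover norm. -/
noncomputable def sparseEmdError {l : ℕ} (k : ℕ) (x : Pixel l → ℝ) : ℝ :=
  sInf ((fun x' => emdNorm (x - x')) '' sparseVectors l k)

/-!
The sketch is `A = B * W`, where `B` is a random sign matrix with `O(k log (n / k))` rows, and the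
image is recovered by minimizing the tree-approximation error over all coefficient vectors with the
given sketch (`ModelRIP.exists_recovery`). Write `L = log (n / k)`; then `K` is of order `k L`.

*Measurements.* There are at most `32 ^ D` rooted subtrees with at most `D` vertices
(`card_rooted_subtrees_le`, a percolation argument). A union bound over nets of the corresponding
coordinate subspaces (`exists_matrix_norm_bounds`) shows that some normalized sign matrix with `O(D)`
rows preserves, up to constant factors, the Euclidean norm of all vectors supported on such a tree
(`ModelRIP`). This is used for `D = 3 K`.

*From `ℓ₂` to `ℓ₁`.* Any `k` vertices of the tree lie in a rooted subtree with at most `K` vertices: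
the levels of depth less than `log₄ k` have at most `k` vertices together, and only `O(L)` levels
are left. Let `h` be in the kernel of `B`, let `S` be a tree of size `2 K`, and let `t` be the `ℓ₁`
norm of `h` off `S`. Enlarge `S` by at most `K` vertices to contain all coordinates exceeding
`t / k` in modulus. As the remaining part of `h` is flat, `B` maps it to a vector of norm `O(t / √k)`
(`subadditive_le_of_sparse_bound`). This bounds the Euclidean norm of `h` on the tree, hence its
`ℓ₁` norm by `O(√(K / k) t) = O(√L t)`. This is the null space property `ModelRIP.l1Norm_le`, and the only place where the factor `√L` arises.

*Earth-Mover distance.* The Haar system is complete, because the projection kernels telescope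
(`haarMatrix_transpose_mul_self`), and every wavelet has mass zero on its cell, so the Earth-Mover
norm is at most `8` times the `ℓ₁` norm of the rescaled coefficients (`emdNorm_haarSynth_le`).
Conversely, for `x ≥ 0` and a `k`-sparse `x'` supported on `P`, the tree of all cells close to `P`
has at most `227 k L` vertices. A unit mass at distance `D` from `P` has off this tree only
coefficients of total size at most `D`, while the distance to `P` is a dual certificate for the
Earth-Mover norm of `x - x'` (`treeError_le_sparseEmdError`).
-/

/-! ### Exponential moments of random sign sums -/

/-- The sign `±1` encoded by a Boolean. -/
def boolSign (b : Bool) : ℝ := if b then 1 else -1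

theorem boolSign_not (b : Bool) : boolSign (!b) = -boolSign b := by
  cases b <;> simp [boolSign]

theorem boolSign_sq (b : Bool) : boolSign b ^ 2 = 1 := by
  cases b <;> simp [boolSign]

theorem sum_flip {ι : Type*} [Fintype ι] [DecidableEq ι] (j : ι) (g : (ι → Bool) → ℝ) :
    ∑ ε, g (Function.update ε j (!ε j)) = ∑ ε, g ε := by
  have hinv : Function.Involutive fun ε : ι → Bool => Function.update ε j (!ε j) := by
    intro ε
    simp
  exact Equiv.sum_comp (hinv.toPerm _) g

/-- Averaging `exp (lam * (ε * a + y) ^ 2)` over a sign `ε`, by `cosh t ≤ exp (t ^ 2 / 2)`. -/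
theorem exp_add_exp_le (lam a y : ℝ) :
    Real.exp (lam * (a + y) ^ 2) + Real.exp (lam * (-a + y) ^ 2) ≤
      2 * (Real.exp (lam * a ^ 2) * Real.exp ((lam + 2 * lam ^ 2 * a ^ 2) * y ^ 2)) := by
  have h := Real.cosh_le_exp_half_sq (2 * lam * a * y)
  rw [Real.cosh_eq] at h
  have e1 : Real.exp (lam * (a + y) ^ 2) =
      Real.exp (lam * a ^ 2 + lam * y ^ 2) * Real.exp (2 * lam * a * y) := by
    rw [← Real.exp_add]; ring_nf
  have e2 : Real.exp (lam * (-a + y) ^ 2) =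
      Real.exp (lam * a ^ 2 + lam * y ^ 2) * Real.exp (-(2 * lam * a * y)) := by
    rw [← Real.exp_add]; ring_nf
  have e3 : Real.exp (lam * a ^ 2) * Real.exp ((lam + 2 * lam ^ 2 * a ^ 2) * y ^ 2) =
      Real.exp (lam * a ^ 2 + lam * y ^ 2) * Real.exp ((2 * lam * a * y) ^ 2 / 2) := by
    rw [← Real.exp_add, ← Real.exp_add]; ring_nf
  rw [e1, e2, e3]
  have := Real.exp_pos (lam * a ^ 2 + lam * y ^ 2)
  nlinarith

/-- The exponential moments of the square of a Rademacher sum. The signs are averaged out one at a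
time; averaging over the sign of a coordinate `u j` replaces `lam` by `lam + 2 * lam ^ 2 * u j ^ 2`,
for either sign of `lam`, and the hypothesis keeps this parameter in `[-M, M]`. -/
theorem sum_exp_mul_sq_le {ι : Type*} [Fintype ι] [DecidableEq ι] (u : ι → ℝ) (M : ℝ)
    (s : Finset ι) (lam : ℝ) (hlam : |lam| + 2 * M ^ 2 * ∑ j ∈ s, u j ^ 2 ≤ M) :
    ∑ ε : ι → Bool, Real.exp (lam * (∑ j ∈ s, boolSign (ε j) * u j) ^ 2) ≤
      Fintype.card (ι → Bool) *
        Real.exp ((lam + 2 * M ^ 2 * ∑ j ∈ s, u j ^ 2) * ∑ j ∈ s, u j ^ 2) := by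
  induction s using Finset.induction_on generalizing lam with
  | empty => simp
  | insert j s hj ih =>
    rw [Finset.sum_insert hj] at hlam ⊢
    set σ := ∑ j ∈ s, u j ^ 2 with hσ
    have hσ0 : 0 ≤ σ := Finset.sum_nonneg fun _ _ => sq_nonneg _
    have hlM : lam ^ 2 ≤ M ^ 2 := by
      apply sq_le_sq'
      · nlinarith [neg_abs_le lam, sq_nonneg M, sq_nonneg (u j), mul_nonneg (sq_nonneg M) hσ0,
          mul_nonneg (sq_nonneg M) (sq_nonneg (u j))]
      · nlinarith [le_abs_self lam, sq_nonneg M, sq_nonneg (u j), mul_nonneg (sq_nonneg M) hσ0,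
          mul_nonneg (sq_nonneg M) (sq_nonneg (u j))]
    have hlu : 2 * lam ^ 2 * u j ^ 2 ≤ 2 * M ^ 2 * u j ^ 2 := by
      nlinarith [sq_nonneg (u j)]
    have hlu0 : 0 ≤ 2 * lam ^ 2 * u j ^ 2 := by positivity
    set lam' := lam + 2 * lam ^ 2 * u j ^ 2 with hlam'
    have habs : |lam'| ≤ |lam| + 2 * lam ^ 2 * u j ^ 2 :=
      (abs_add_le _ _).trans_eq (by rw [abs_of_nonneg hlu0])
    have key := ih lam' (by nlinarith)
    have hpt : ∀ ε : ι → Bool,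
        Real.exp (lam * (∑ i ∈ insert j s, boolSign (ε i) * u i) ^ 2) +
        Real.exp (lam * (∑ i ∈ insert j s,
          boolSign (Function.update ε j (!ε j) i) * u i) ^ 2) ≤
        2 * (Real.exp (lam * u j ^ 2) *
          Real.exp (lam' * (∑ i ∈ s, boolSign (ε i) * u i) ^ 2)) := by
      intro ε
      rw [Finset.sum_insert hj, Finset.sum_insert hj]
      have hsame : ∑ i ∈ s, boolSign (Function.update ε j (!ε j) i) * u i =
          ∑ i ∈ s, boolSign (ε i) * u i := by
        refine Finset.sum_congr rfl fun i hi => ?_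
        rw [Function.update_of_ne (ne_of_mem_of_not_mem hi hj)]
      rw [hsame, Function.update_self, boolSign_not]
      have h := exp_add_exp_le lam (boolSign (ε j) * u j) (∑ i ∈ s, boolSign (ε i) * u i)
      rw [mul_pow, boolSign_sq, one_mul] at h
      rw [neg_mul]
      exact h
    have hsum := Finset.sum_le_sum fun ε (_ : ε ∈ Finset.univ) => hpt ε
    rw [Finset.sum_add_distrib,
      sum_flip j fun ε => Real.exp (lam * (∑ i ∈ insert j s, boolSign (ε i) * u i) ^ 2),
      ← Finset.mul_sum, ← Finset.mul_sum] at hsum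
    have hfin : Real.exp (lam * u j ^ 2) *
        Real.exp ((lam' + 2 * M ^ 2 * σ) * σ) ≤
        Real.exp ((lam + 2 * M ^ 2 * (u j ^ 2 + σ)) * (u j ^ 2 + σ)) := by
      rw [← Real.exp_add]
      apply Real.exp_le_exp.2
      have h1 : 0 ≤ 2 * M ^ 2 * (u j ^ 2 + σ) * u j ^ 2 := by positivity
      nlinarith
    calc _ ≤ Real.exp (lam * u j ^ 2) *
          ∑ ε : ι → Bool, Real.exp (lam' * (∑ i ∈ s, boolSign (ε i) * u i) ^ 2) := by linarith
      _ ≤ Real.exp (lam * u j ^ 2) * (Fintype.card (ι → Bool) *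
          Real.exp ((lam' + 2 * M ^ 2 * σ) * σ)) := by gcongr
      _ = Fintype.card (ι → Bool) * (Real.exp (lam * u j ^ 2) *
          Real.exp ((lam' + 2 * M ^ 2 * σ) * σ)) := by ring
      _ ≤ _ := by gcongr

/-- The squared Euclidean norm of the image of `u` under the sign matrix encoded by `ω`. -/
def signEnergy {ι : Type*} [Fintype ι] {m : ℕ} (ω : Fin m → ι → Bool) (u : ι → ℝ) : ℝ :=
  ∑ i, (∑ j, boolSign (ω i j) * u j) ^ 2

/-- The rows are independent, so the exponential moment of the energy is a power of that of a
single row. For `lam = ± 1 / 16` the parameters stay in `[-1 / 8, 1 / 8]`. -/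
theorem sum_exp_mul_signEnergy_le {ι : Type*} [Fintype ι] [DecidableEq ι] (m : ℕ) (u : ι → ℝ)
    (hu : ∑ j, u j ^ 2 = 1) (lam : ℝ) (hlam : |lam| = 1 / 16) :
    ∑ ω : Fin m → ι → Bool, Real.exp (lam * signEnergy ω u) ≤
      Fintype.card (Fin m → ι → Bool) * Real.exp (m * (lam + 1 / 32)) := by
  have h := sum_exp_mul_sq_le u (1 / 8) Finset.univ lam (by rw [hu, hlam]; norm_num)
  have e : ∀ ω : Fin m → ι → Bool, Real.exp (lam * signEnergy ω u) =
      ∏ i, Real.exp (lam * (∑ j, boolSign (ω i j) * u j) ^ 2) := by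
    intro ω
    rw [signEnergy, Finset.mul_sum, Real.exp_sum]
  have hprod : ∑ ω : Fin m → ι → Bool, Real.exp (lam * signEnergy ω u) =
      (∑ ε : ι → Bool, Real.exp (lam * (∑ j, boolSign (ε j) * u j) ^ 2)) ^ m := by
    rw [Finset.sum_congr rfl fun ω _ => e ω, Finset.sum_pow', Fintype.piFinset_univ]
  rw [hprod]
  refine (pow_le_pow_left₀ (Finset.sum_nonneg fun _ _ => (Real.exp_pos _).le) h m).trans_eq ?_
  rw [mul_pow, ← Real.exp_nat_mul, hu, Fintype.card_fun (α := Fin m),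
    Fintype.card_fin]
  push_cast
  norm_num

/-- Markov's inequality for exponential moments. -/
theorem card_filter_mul_exp_le {Ω : Type*} [Fintype Ω] (p : Ω → Prop) [DecidablePred p]
    (g : Ω → ℝ) (t : ℝ) (h : ∀ ω, p ω → t ≤ g ω) :
    ((Finset.univ.filter p).card : ℝ) * Real.exp t ≤ ∑ ω, Real.exp (g ω) := by
  calc ((Finset.univ.filter p).card : ℝ) * Real.exp t
      = ∑ _ω ∈ Finset.univ.filter p, Real.exp t := by simp
    _ ≤ ∑ ω ∈ Finset.univ.filter p, Real.exp (g ω) :=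
        Finset.sum_le_sum fun ω hω => Real.exp_le_exp.2 (h ω (Finset.mem_filter.1 hω).2)
    _ ≤ _ := Finset.sum_le_sum_of_subset_of_nonneg (Finset.filter_subset _ _)
        fun _ _ _ => (Real.exp_pos _).le

open Classical in
/-- A random sign matrix nearly preserves a fixed vector, up to an exponentially small fraction of
exceptions. -/
theorem card_signEnergy_bad_le {ι : Type*} [Fintype ι] (m : ℕ) (u : ι → ℝ) :
    ((Finset.univ.filter fun ω : Fin m → ι → Bool =>
      ¬ (m / 4 * ∑ j, u j ^ 2 ≤ signEnergy ω u ∧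
        signEnergy ω u ≤ 2 * m * ∑ j, u j ^ 2)).card : ℝ) ≤
      2 * Real.exp (-(m / 64)) * Fintype.card (Fin m → ι → Bool) := by
  -- reduction to vectors of norm one
  wlog hu : ∑ j, u j ^ 2 = 1 generalizing u
  · set σ := ∑ j, u j ^ 2 with hσ
    rcases (Finset.sum_nonneg fun j _ => sq_nonneg (u j) : 0 ≤ ∑ j, u j ^ 2).eq_or_lt with h0 | h0
    · have hz : ∀ j, u j = 0 := fun j => by
        have := (Finset.sum_eq_zero_iff_of_nonneg fun j _ => sq_nonneg (u j)).1 h0.symm j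
          (Finset.mem_univ j)
        exact pow_eq_zero_iff (two_ne_zero) |>.1 this
      rw [Finset.filter_false_of_mem]
      · simp only [Finset.card_empty, Nat.cast_zero]; positivity
      · intro ω _
        rw [show σ = 0 from h0.symm]
        simp [signEnergy, hz]
    · change 0 < σ at h0
      have hs : 0 < √σ := Real.sqrt_pos.2 h0
      have hscale : ∑ j, (u j / √σ) ^ 2 = 1 := by
        simp_rw [div_pow, Real.sq_sqrt h0.le]
        rw [← Finset.sum_div, div_self h0.ne']
      have := this (fun j => u j / √σ) hscale
      refine le_trans (le_of_eq ?_) this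
      congr 2
      refine Finset.filter_congr fun ω _ => ?_
      have he : signEnergy ω (fun j => u j / √σ) = signEnergy ω u / σ := by
        simp only [signEnergy, Finset.sum_div]
        refine Finset.sum_congr rfl fun i _ => ?_
        simp only [← mul_div_assoc]
        rw [← Finset.sum_div, div_pow, Real.sq_sqrt h0.le]
      rw [he, hscale, mul_one, mul_one, le_div_iff₀ h0, div_le_iff₀ h0]
  rw [hu, mul_one, mul_one]
  have hsub : (Finset.univ.filter fun ω : Fin m → ι → Bool =>
      ¬ (m / 4 ≤ signEnergy ω u ∧ signEnergy ω u ≤ 2 * m)) ⊆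
      (Finset.univ.filter fun ω : Fin m → ι → Bool => signEnergy ω u < m / 4) ∪
      (Finset.univ.filter fun ω : Fin m → ι → Bool => (2 * m : ℝ) < signEnergy ω u) := by
    intro ω hω
    simp only [Finset.mem_filter, Finset.mem_univ, true_and, Finset.mem_union] at hω ⊢
    by_contra hcon
    push Not at hcon
    exact hω hcon
  have hcard := (Finset.card_le_card hsub).trans (Finset.card_union_le _ _)
  have hlow := card_filter_mul_exp_le (fun ω : Fin m → ι → Bool => signEnergy ω u < m / 4)
    (fun ω => -(1 / 16) * signEnergy ω u) (-(m / 64)) (fun ω hω => by linarith)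
  have hup := card_filter_mul_exp_le (fun ω : Fin m → ι → Bool => (2 * m : ℝ) < signEnergy ω u)
    (fun ω => 1 / 16 * signEnergy ω u) (m / 8) (fun ω hω => by linarith)
  have h1 := hlow.trans (sum_exp_mul_signEnergy_le m u hu (-(1 / 16)) (by norm_num [abs_of_pos]))
  have h2 := hup.trans (sum_exp_mul_signEnergy_le m u hu (1 / 16) (by norm_num [abs_of_pos]))
  rw [← le_div_iff₀ (Real.exp_pos _), mul_div_assoc, ← Real.exp_sub] at h1 h2
  have e1 : (m : ℝ) * (-(1 / 16) + 1 / 32) - -(m / 64) = -(m / 64) := by ring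
  have e2 : Real.exp ((m : ℝ) * (1 / 16 + 1 / 32) - m / 8) ≤ Real.exp (-(m / 64)) := by
    apply Real.exp_le_exp.2
    have : (0 : ℝ) ≤ m := Nat.cast_nonneg m
    linarith
  rw [e1] at h1
  have h3 := h2.trans (mul_le_mul_of_nonneg_left e2 (Nat.cast_nonneg _))
  have hcard' := (Nat.cast_le (α := ℝ)).2 hcard
  push_cast at hcard' h1 h3 ⊢
  linarith

/-! ### Random embeddings of unions of subspaces -/

/-- A maximal `1`-separated subset of the ball of radius `2` is a net, of size controlled by
volume. -/
theorem exists_net_one {E : Type*} [NormedAddCommGroup E] [NormedSpace ℝ E]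
    [FiniteDimensional ℝ E] :
    ∃ N : Finset E, N.card ≤ 5 ^ Module.finrank ℝ E ∧ ∀ x : E, ‖x‖ ≤ 2 → ∃ a ∈ N, ‖x - a‖ ≤ 1 := by
  classical
  set P : ℕ → Prop := fun n => ∃ s : Finset E, s.card = n ∧ (∀ c ∈ s, ‖c‖ ≤ 2) ∧
    ∀ c ∈ s, ∀ d ∈ s, c ≠ d → 1 ≤ ‖c - d‖ with hP
  obtain ⟨s, hcard, hs, hsep⟩ : P (Nat.findGreatest P (5 ^ Module.finrank ℝ E)) :=
    Nat.findGreatest_spec (Nat.zero_le _) ⟨∅, by simp⟩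
  refine ⟨s, Besicovitch.card_le_of_separated s hs hsep, fun x hx => ?_⟩
  by_contra! hfar
  have hxs : x ∉ s := fun h => by
    have := hfar x h
    simp at this
    linarith
  -- otherwise `x` could be added to a separated set of maximal size
  have hs' : ∀ c ∈ insert x s, ‖c‖ ≤ 2 := by
    intro c hc
    rcases Finset.mem_insert.1 hc with rfl | hc
    · exact hx
    · exact hs c hc
  have hsep' : ∀ c ∈ insert x s, ∀ d ∈ insert x s, c ≠ d → 1 ≤ ‖c - d‖ := by
    intro c hc d hd hcd
    rcases Finset.mem_insert.1 hc with hc | hc <;> rcases Finset.mem_insert.1 hd with hd | hd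
    · exact absurd (hc.trans hd.symm) hcd
    · rw [hc]
      exact (hfar d hd).le
    · rw [hd, norm_sub_rev]
      exact (hfar c hc).le
    · exact hsep c hc d hd hcd
  have hle := Nat.le_findGreatest (P := P) (Besicovitch.card_le_of_separated _ hs' hsep')
    ⟨_, rfl, hs', hsep'⟩
  rw [Finset.card_insert_of_notMem hxs] at hle
  omega

/-- Finer nets, by covering each ball again with balls of half the radius. -/
theorem exists_net_pow {E : Type*} [NormedAddCommGroup E] [NormedSpace ℝ E]
    [FiniteDimensional ℝ E] (j : ℕ) :
    ∃ N : Finset E, N.card ≤ (5 ^ Module.finrank ℝ E) ^ j ∧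
      ∀ x : E, ‖x‖ ≤ 2 → ∃ a ∈ N, ‖x - a‖ ≤ 2 / 2 ^ j := by
  classical
  induction j with
  | zero => exact ⟨{0}, by simp, fun x hx => ⟨0, by simp, by simpa using hx⟩⟩
  | succ j ih =>
    obtain ⟨N, hN, hnet⟩ := ih
    obtain ⟨N₁, hN₁, hnet₁⟩ := exists_net_one (E := E)
    refine ⟨Finset.image₂ (fun a b => a + ((2 : ℝ) ^ j)⁻¹ • b) N N₁, ?_, fun x hx => ?_⟩
    · rw [pow_succ]
      exact Finset.card_image₂_le _ _ _ |>.trans (Nat.mul_le_mul hN hN₁)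
    · obtain ⟨a, ha, hxa⟩ := hnet x hx
      have h2 : (0 : ℝ) < 2 ^ j := by positivity
      obtain ⟨b, hb, hxb⟩ := hnet₁ ((2 : ℝ) ^ j • (x - a)) (by
        rw [norm_smul, Real.norm_of_nonneg h2.le]
        calc (2 : ℝ) ^ j * ‖x - a‖ ≤ 2 ^ j * (2 / 2 ^ j) := by gcongr
          _ = 2 := by field_simp)
      refine ⟨_, Finset.mem_image₂_of_mem ha hb, ?_⟩
      have e : x - (a + ((2 : ℝ) ^ j)⁻¹ • b) =
          ((2 : ℝ) ^ j)⁻¹ • ((2 : ℝ) ^ j • (x - a) - b) := by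
        rw [smul_sub, smul_smul, inv_mul_cancel₀ h2.ne', one_smul]
        abel
      rw [e, norm_smul, Real.norm_of_nonneg (inv_pos.2 h2).le]
      calc ((2 : ℝ) ^ j)⁻¹ * ‖(2 : ℝ) ^ j • (x - a) - b‖ ≤ ((2 : ℝ) ^ j)⁻¹ * 1 := by gcongr
        _ = 2 / 2 ^ (j + 1) := by rw [pow_succ]; field_simp

/-- A finite set of directions that contains every vector up to an eighth of its length. -/
theorem exists_net_directions (E : Type*) [NormedAddCommGroup E] [NormedSpace ℝ E]
    [FiniteDimensional ℝ E] :
    ∃ N : Finset E, N.card ≤ 125 ^ Module.finrank ℝ E ∧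
      ∀ x : E, ∃ a ∈ N, ∃ r : ℝ, ‖x - r • a‖ ≤ ‖x‖ / 8 := by
  obtain ⟨N, hN, hnet⟩ := exists_net_pow (E := E) 3
  refine ⟨N, hN.trans_eq (by rw [← pow_mul, mul_comm, pow_mul]; norm_num), fun x => ?_⟩
  by_cases hx : x = 0
  · obtain ⟨a, ha, -⟩ := hnet 0 (by simp)
    exact ⟨a, ha, 0, by simp [hx]⟩
  · have hx' : 0 < ‖x‖ := norm_pos_iff.2 hx
    obtain ⟨a, ha, h⟩ := hnet ((2 / ‖x‖) • x) (by
      rw [norm_smul, Real.norm_of_nonneg (by positivity), div_mul_cancel₀ _ hx'.ne'])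
    refine ⟨a, ha, ‖x‖ / 2, ?_⟩
    have e : x - (‖x‖ / 2) • a = (‖x‖ / 2) • ((2 / ‖x‖) • x - a) := by
      rw [smul_sub, smul_smul]
      have : ‖x‖ / 2 * (2 / ‖x‖) = 1 := by field_simp
      rw [this, one_smul]
    rw [e, norm_smul, Real.norm_of_nonneg (by positivity)]
    calc ‖x‖ / 2 * ‖(2 / ‖x‖) • x - a‖ ≤ ‖x‖ / 2 * (2 / 2 ^ 3) := by gcongr
      _ = ‖x‖ / 8 := by ring

/-- Bounds on a net extend to the whole space. The approximation error is absorbed into the operator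
norm, which is at most `(27 / 16) / (7 / 8) < 2`. -/
theorem norm_bounds_of_net {E F : Type*} [NormedAddCommGroup E] [NormedSpace ℝ E]
    [NormedAddCommGroup F] [NormedSpace ℝ F] (L : E →L[ℝ] F) (N : Finset E)
    (hnet : ∀ x : E, ∃ a ∈ N, ∃ r : ℝ, ‖x - r • a‖ ≤ ‖x‖ / 8)
    (hN : ∀ a ∈ N, ‖a‖ / 2 ≤ ‖L a‖ ∧ ‖L a‖ ≤ 3 / 2 * ‖a‖) (x : E) :
    ‖x‖ / 8 ≤ ‖L x‖ ∧ ‖L x‖ ≤ 2 * ‖x‖ := by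
  have hN' : ∀ a ∈ N, ∀ r : ℝ, ‖r • a‖ / 2 ≤ ‖L (r • a)‖ ∧ ‖L (r • a)‖ ≤ 3 / 2 * ‖r • a‖ := by
    intro a ha r
    obtain ⟨h1, h2⟩ := hN a ha
    rw [map_smul, norm_smul, norm_smul]
    have := norm_nonneg r
    constructor <;> nlinarith
  have hop : ‖L‖ ≤ 27 / 16 + ‖L‖ / 8 := by
    refine L.opNorm_le_bound (by positivity) fun y => ?_
    obtain ⟨a, ha, r, hr⟩ := hnet y
    have h1 : ‖L y‖ ≤ ‖L (r • a)‖ + ‖L (y - r • a)‖ := by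
      have := norm_add_le (L (r • a)) (L (y - r • a))
      rwa [← map_add, add_sub_cancel] at this
    have h2 := (hN' a ha r).2
    have h3 := L.le_opNorm (y - r • a)
    have h4 : ‖r • a‖ ≤ ‖y‖ + ‖y‖ / 8 := by
      have := norm_sub_le y (y - r • a)
      rw [sub_sub_cancel] at this
      linarith
    have h5 : ‖L‖ * ‖y - r • a‖ ≤ ‖L‖ * (‖y‖ / 8) := by gcongr
    linarith
  have hupper : ∀ y, ‖L y‖ ≤ 2 * ‖y‖ := fun y =>
    (L.le_opNorm y).trans (by gcongr; linarith)
  refine ⟨?_, hupper x⟩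
  obtain ⟨a, ha, r, hr⟩ := hnet x
  have h1 := (hN' a ha r).1
  have h2 := hupper (x - r • a)
  have h3 : ‖L (r • a)‖ ≤ ‖L x‖ + ‖L (x - r • a)‖ := by
    have := norm_sub_le (L x) (L (x - r • a))
    rwa [← map_sub, sub_sub_cancel] at this
  have h4 : ‖x‖ ≤ ‖r • a‖ + ‖x - r • a‖ := by
    simpa using norm_add_le (r • a) (x - r • a)
  linarith [norm_nonneg x]

/-- The random sign matrix encoded by `ω`, normalized so that its columns are unit vectors. -/
noncomputable def signMatrix {ι : Type*} {m : ℕ} (ω : Fin m → ι → Bool) : Matrix (Fin m) ι ℝ :=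
  Matrix.of fun i j => boolSign (ω i j) / √m

theorem norm_sq_signMatrix {ι : Type*} [Fintype ι] [DecidableEq ι] {m : ℕ}
    (ω : Fin m → ι → Bool) (u : EuclideanSpace ℝ ι) :
    ‖Matrix.toEuclideanLin (signMatrix ω) u‖ ^ 2 = signEnergy ω u / m := by
  rw [EuclideanSpace.norm_sq_eq, signEnergy, Finset.sum_div]
  refine Finset.sum_congr rfl fun i _ => ?_
  have : (Matrix.toEuclideanLin (signMatrix ω) u).ofLp i =
      (∑ j, boolSign (ω i j) * u j) / √m := by
    change (signMatrix ω).mulVec u.ofLp i = _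
    rw [Matrix.mulVec, dotProduct, Finset.sum_div]
    refine Finset.sum_congr rfl fun j _ => ?_
    rw [signMatrix, Matrix.of_apply]
    ring
  rw [this, Real.norm_eq_abs, sq_abs, div_pow, Real.sq_sqrt (Nat.cast_nonneg m)]

/-- Few random linear measurements embed exponentially many low-dimensional subspaces almost
isometrically: a union bound over nets of all the subspaces. -/
theorem exists_matrix_norm_bounds {ι κ : Type*} [Fintype ι] [DecidableEq ι] [Fintype κ]
    (V : κ → Submodule ℝ (EuclideanSpace ℝ ι)) (D : ℕ) (hD : 1 ≤ D)
    (hκ : Fintype.card κ ≤ 32 ^ D) (hV : ∀ k, Module.finrank ℝ (V k) ≤ D) :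
    ∃ B : Matrix (Fin (640 * D)) ι ℝ, ∀ k, ∀ u ∈ V k,
      ‖u‖ / 8 ≤ ‖Matrix.toEuclideanLin B u‖ ∧ ‖Matrix.toEuclideanLin B u‖ ≤ 2 * ‖u‖ := by
  classical
  choose N hNcard hnet using fun k => exists_net_directions (V k)
  set m := 640 * D with hm
  have hm0 : (0 : ℝ) < m := by rw [hm]; push_cast; positivity
  set bad : EuclideanSpace ℝ ι → Finset (Fin m → ι → Bool) := fun u =>
    Finset.univ.filter fun ω : Fin m → ι → Bool =>
      ¬ (m / 4 * ∑ j, u j ^ 2 ≤ signEnergy ω u ∧ signEnergy ω u ≤ 2 * m * ∑ j, u j ^ 2) with hbad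
  have hexists : ∃ ω : Fin m → ι → Bool, ∀ k, ∀ a ∈ N k, ω ∉ bad a := by
    by_contra! hcon
    have hcover : (Finset.univ : Finset (Fin m → ι → Bool)) ⊆
        Finset.univ.biUnion fun k => (N k).biUnion fun a => bad a := by
      intro ω _
      obtain ⟨k, a, ha, h⟩ := hcon ω
      exact Finset.mem_biUnion.2 ⟨k, Finset.mem_univ _, Finset.mem_biUnion.2 ⟨a, ha, h⟩⟩
    set Ω : ℝ := (Fintype.card (Fin m → ι → Bool) : ℝ) with hΩ
    have hΩ0 : 0 < Ω := by rw [hΩ]; exact_mod_cast Fintype.card_pos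
    set q : ℝ := 2 * Real.exp (-(m / 64)) * Ω with hq
    have hq0 : 0 ≤ q := by positivity
    have hbadq : ∀ u, ((bad u).card : ℝ) ≤ q := fun u => by
      have := card_signEnergy_bad_le m (u : ι → ℝ)
      convert this
    have h1 : ∀ k, ((((N k).biUnion fun a => bad a).card : ℕ) : ℝ) ≤ 125 ^ D * q := fun k => by
      calc ((((N k).biUnion fun a => bad a).card : ℕ) : ℝ)
          ≤ ((∑ a ∈ N k, (bad a).card : ℕ) : ℝ) := by exact_mod_cast Finset.card_biUnion_le
        _ = ∑ a ∈ N k, ((bad a).card : ℝ) := by push_cast; rfl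
        _ ≤ ∑ _a ∈ N k, q := Finset.sum_le_sum fun a _ => hbadq a
        _ = (N k).card * q := by simp
        _ ≤ 125 ^ D * q := by
          gcongr
          have := (hNcard k).trans (Nat.pow_le_pow_right (by norm_num) (hV k))
          exact_mod_cast this
    have h2 : Ω ≤ 32 ^ D * (125 ^ D * q) := by
      calc Ω = (((Finset.univ : Finset (Fin m → ι → Bool)).card : ℕ) : ℝ) := by
            rw [Finset.card_univ]
        _ ≤ ((∑ k, ((N k).biUnion fun a => bad a).card : ℕ) : ℝ) := by
          exact_mod_cast (Finset.card_le_card hcover).trans Finset.card_biUnion_le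
        _ = ∑ k, ((((N k).biUnion fun a => bad a).card : ℕ) : ℝ) := by push_cast; rfl
        _ ≤ ∑ _k : κ, 125 ^ D * q := Finset.sum_le_sum fun k _ => h1 k
        _ = Fintype.card κ * (125 ^ D * q) := by simp
        _ ≤ 32 ^ D * (125 ^ D * q) := by
          gcongr
          exact_mod_cast hκ
    have hexp : Real.exp (-(m / 64 : ℝ)) = (Real.exp (-1) ^ 10) ^ D := by
      rw [← Real.exp_nat_mul, ← Real.exp_nat_mul, hm]
      push_cast
      ring_nf
    -- `32 * 125 = 4000` directions per dimension, against a failure rate of `2 * exp (-10)`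
    have hsmall : 4000 * Real.exp (-1) ^ 10 < 1 / 2 := by
      have h0 := Real.exp_pos (-1)
      have h := Real.exp_neg_one_lt_d9
      calc 4000 * Real.exp (-1) ^ 10 ≤ 4000 * (0.37 : ℝ) ^ 10 := by
            gcongr
            linarith
        _ < 1 / 2 := by norm_num
    have hsmallD : (4000 * Real.exp (-1) ^ 10) ^ D < 1 / 2 := by
      refine lt_of_le_of_lt (pow_le_of_le_one (by positivity) (by linarith) (by omega)) hsmall
    have h3 : 32 ^ D * (125 ^ D * q) = 2 * (4000 * Real.exp (-1) ^ 10) ^ D * Ω := by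
      rw [hq, hexp, mul_pow (4000 : ℝ), show (4000 : ℝ) = 32 * 125 by norm_num, mul_pow]
      ring
    rw [h3] at h2
    nlinarith
  obtain ⟨ω, hω⟩ := hexists
  refine ⟨signMatrix ω, fun k u hu => ?_⟩
  refine norm_bounds_of_net
    ((LinearMap.toContinuousLinearMap (Matrix.toEuclideanLin (signMatrix ω))).comp (V k).subtypeL)
    (N k) (hnet k) (fun a ha => ?_) ⟨u, hu⟩
  have h := hω k a ha
  simp only [hbad, Finset.mem_filter, Finset.mem_univ, true_and, not_not] at h
  have hn := norm_sq_signMatrix ω (a : EuclideanSpace ℝ ι)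
  have ha2 : ‖(a : EuclideanSpace ℝ ι)‖ ^ 2 = ∑ j, (a : EuclideanSpace ℝ ι) j ^ 2 := by
    rw [EuclideanSpace.norm_sq_eq]
    simp
  rw [← ha2] at h
  change ‖(a : EuclideanSpace ℝ ι)‖ / 2 ≤ ‖Matrix.toEuclideanLin (signMatrix ω) a‖ ∧
    ‖Matrix.toEuclideanLin (signMatrix ω) a‖ ≤ 3 / 2 * ‖(a : EuclideanSpace ℝ ι)‖
  have hl : ‖(a : EuclideanSpace ℝ ι)‖ ^ 2 / 4 ≤ signEnergy ω a / m := by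
    rw [le_div_iff₀ hm0]; linarith [h.1]
  have hu' : signEnergy ω a / m ≤ 2 * ‖(a : EuclideanSpace ℝ ι)‖ ^ 2 := by
    rw [div_le_iff₀ hm0]; linarith [h.2]
  rw [← hn] at hl hu'
  constructor
  · apply le_of_sq_le_sq _ (norm_nonneg _)
    linarith
  · apply le_of_sq_le_sq _ (by positivity)
    nlinarith [sq_nonneg ‖(a : EuclideanSpace ℝ ι)‖]

/-! ### Counting rooted subtrees -/

open Classical in
/-- The number of rooted subtrees with at most `K` vertices of a tree with at most four children
per vertex is at most `32 ^ K`. Every rooted subtree `S` occurs as the connected component of the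
root in a random set `T` of vertices with probability at least `2 ^ (-5 * K)`, since this only
prescribes which of the at most `5 * K` vertices of `S` and its boundary belong to `T`; for
different `S` these events are disjoint. -/
theorem card_rooted_subtrees_le {α : Type*} [Fintype α] (r : α → α → Prop) (root : α)
    (depth : α → ℕ) (hdepth : ∀ p q, r p q → depth p < depth q)
    (hparent : ∀ q, q ≠ root → ∃ p, r p q)
    (hchildren : ∀ p, (Finset.univ.filter fun q => r p q).card ≤ 4) (K : ℕ)
    (F : Finset (Finset α)) (hroot : ∀ S ∈ F, root ∈ S)
    (hclosed : ∀ S ∈ F, ∀ p q, r p q → q ∈ S → p ∈ S) (hcard : ∀ S ∈ F, S.card ≤ K) :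
    F.card ≤ 32 ^ K := by
  set bd : Finset α → Finset α := fun S => Finset.univ.filter fun q => q ∉ S ∧ ∃ p ∈ S, r p q
    with hbd
  set ev : Finset α → Finset (Finset α) := fun S =>
    Finset.univ.filter fun T => S ⊆ T ∧ Disjoint T (bd S) with hev
  have hbd_card : ∀ S, (bd S).card ≤ 4 * S.card := by
    intro S
    have hsub : bd S ⊆ S.biUnion fun p => Finset.univ.filter fun q => r p q := by
      intro q hq
      obtain ⟨-, p, hp, hpq⟩ := (Finset.mem_filter.1 hq).2
      exact Finset.mem_biUnion.2 ⟨p, hp, Finset.mem_filter.2 ⟨Finset.mem_univ _, hpq⟩⟩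
    calc (bd S).card ≤ _ := Finset.card_le_card hsub
      _ ≤ S.card * 4 := Finset.card_biUnion_le_card_mul _ _ _ fun p _ => hchildren p
      _ = 4 * S.card := mul_comm _ _
  have hev_card : ∀ S ∈ F, 2 ^ Fintype.card α ≤ (ev S).card * 2 ^ (5 * K) := by
    intro S hS
    have hinj : (Finset.univ : Finset (Finset α)).card ≤
        (ev S ×ˢ (S ∪ bd S).powerset).card := by
      refine Finset.card_le_card_of_injOn (fun T => (T \ bd S ∪ S, T ∩ (S ∪ bd S))) ?_ ?_
      · intro T _
        refine Finset.mem_coe.2 (Finset.mem_product.2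
          ⟨Finset.mem_filter.2 ⟨Finset.mem_univ _, Finset.subset_union_right, ?_⟩,
            Finset.mem_powerset.2 Finset.inter_subset_right⟩)
        rw [Finset.disjoint_union_left]
        refine ⟨Finset.sdiff_disjoint, Finset.disjoint_left.2 fun q hq hq' => ?_⟩
        exact (Finset.mem_filter.1 hq').2.1 hq
      · intro T _ T' _ h
        obtain ⟨h1, h2⟩ := Prod.mk.inj h
        ext q
        have h1q := congrArg (q ∈ ·) h1
        have h2q := congrArg (q ∈ ·) h2
        simp only [Finset.mem_union, Finset.mem_sdiff, Finset.mem_inter, eq_iff_iff] at h1q h2q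
        tauto
    rw [Finset.card_univ, Fintype.card_finset, Finset.card_product, Finset.card_powerset] at hinj
    refine hinj.trans (Nat.mul_le_mul_left _ (Nat.pow_le_pow_right (by norm_num) ?_))
    have h1 := Finset.card_union_le S (bd S)
    have h2 := hbd_card S
    have h3 := hcard S hS
    omega
  have hsubset : ∀ S ∈ F, ∀ S' ∈ F, ∀ T, T ∈ ev S → T ∈ ev S' → S' ⊆ S := by
    intro S hS S' hS' T hT hT' q
    induction hn : depth q using Nat.strong_induction_on generalizing q with
    | _ n ih =>
      intro hq
      by_cases hqr : q = root
      · exact hqr ▸ hroot S hS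
      obtain ⟨p, hpq⟩ := hparent q hqr
      have hpS : p ∈ S := ih (depth p) (hn ▸ hdepth p q hpq) rfl (hclosed S' hS' p q hpq hq)
      by_contra hqS
      have hqT : q ∈ T := (Finset.mem_filter.1 hT').2.1 hq
      exact Finset.disjoint_left.1 (Finset.mem_filter.1 hT).2.2 hqT
        (Finset.mem_filter.2 ⟨Finset.mem_univ _, hqS, p, hpS, hpq⟩)
  have hdisj : (F : Set (Finset α)).PairwiseDisjoint ev := by
    intro S hS S' hS' hne
    refine Finset.disjoint_left.2 fun T hT hT' => hne ?_
    exact (hsubset S' hS' S hS T hT' hT).antisymm (hsubset S hS S' hS' T hT hT')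
  have htotal : F.card * 2 ^ Fintype.card α ≤ 2 ^ Fintype.card α * 2 ^ (5 * K) := by
    calc F.card * 2 ^ Fintype.card α = ∑ _S ∈ F, 2 ^ Fintype.card α := by simp
      _ ≤ ∑ S ∈ F, (ev S).card * 2 ^ (5 * K) := Finset.sum_le_sum hev_card
      _ = (F.biUnion ev).card * 2 ^ (5 * K) := by
        rw [Finset.card_biUnion hdisj, Finset.sum_mul]
      _ ≤ 2 ^ Fintype.card α * 2 ^ (5 * K) := by
        refine Nat.mul_le_mul_right _ ?_
        rw [← Fintype.card_finset]
        exact Finset.card_le_univ _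
  have : F.card ≤ 2 ^ (5 * K) := by
    rw [mul_comm] at htotal
    exact Nat.le_of_mul_le_mul_left htotal (by positivity)
  rwa [pow_mul] at this

theorem DetailIndex.ext' {l : ℕ} {d e : DetailIndex l} (hj : d.1.val = e.1.val)
    (hc : d.col = e.col) (hr : d.row = e.row) (ho : d.orient = e.orient) : d = e := by
  obtain ⟨⟨j, hjl⟩, ⟨a, b⟩, o⟩ := d
  obtain ⟨⟨j', hjl'⟩, ⟨a', b'⟩, o'⟩ := e
  obtain rfl : j = j' := hj
  obtain rfl : a = a' := Fin.ext hc
  obtain rfl : b = b' := Fin.ext hr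
  obtain rfl : o = o' := ho
  rfl

theorem DetailIndex.col_lt {l : ℕ} (d : DetailIndex l) : d.col < 2 ^ d.1.val := d.2.1.1.isLt

theorem DetailIndex.row_lt {l : ℕ} (d : DetailIndex l) : d.row < 2 ^ d.1.val := d.2.1.2.isLt

/-- The depth of a wavelet in the tree. -/
def WaveletIndex.depth {l : ℕ} : WaveletIndex l → ℕ
  | none => 0
  | some d => d.1.val + 1

theorem IsParent.depth_lt {l : ℕ} {p q : WaveletIndex l} (h : IsParent p q) :
    WaveletIndex.depth p < WaveletIndex.depth q := by
  match p, q, h with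
  | none, some d, _ => simp [WaveletIndex.depth]
  | some e, some d, h =>
    have := h.1
    simp only [WaveletIndex.depth]
    omega

theorem exists_isParent {l : ℕ} (q : WaveletIndex l) (hq : q ≠ none) : ∃ p, IsParent p q := by
  obtain ⟨d, rfl⟩ := Option.ne_none_iff_exists'.1 hq
  by_cases hd : d.1.val = 0
  · exact ⟨none, hd⟩
  · have hpow : 2 ^ d.1.val = 2 ^ (d.1.val - 1) * 2 := by
      rw [← pow_succ, Nat.sub_add_cancel (by omega)]
    have hc := d.col_lt
    have hr := d.row_lt
    refine ⟨some ⟨⟨d.1.val - 1, by omega⟩, (⟨d.col / 2, ?_⟩, ⟨d.row / 2, ?_⟩), d.orient⟩,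
      ?_, rfl, rfl, rfl⟩
    · change d.col / 2 < 2 ^ (d.1.val - 1)
      omega
    · change d.row / 2 < 2 ^ (d.1.val - 1)
      omega
    · change d.1.val = d.1.val - 1 + 1
      omega

open Classical in
theorem card_children_le {l : ℕ} (p : WaveletIndex l) :
    (Finset.univ.filter fun q => IsParent p q).card ≤ 4 := by
  match p with
  | none =>
    refine (Finset.card_le_card_of_injOn (t := (Finset.univ : Finset (Fin 3)))
      (fun q => q.elim 0 DetailIndex.orient) (fun _ _ => Finset.mem_coe.2 (Finset.mem_univ _))
      ?_).trans (by simp)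
    intro q hq q' hq' h
    have hq := (Finset.mem_filter.1 (Finset.mem_coe.1 hq)).2
    have hq' := (Finset.mem_filter.1 (Finset.mem_coe.1 hq')).2
    match q, q', hq, hq', h with
    | some d, some e, hd, he, h =>
      change d.1.val = 0 at hd
      change e.1.val = 0 at he
      have h1 := d.col_lt
      have h2 := e.col_lt
      have h3 := d.row_lt
      have h4 := e.row_lt
      rw [hd] at h1 h3
      rw [he] at h2 h4
      exact congrArg some (DetailIndex.ext' (hd.trans he.symm) (by omega) (by omega) h)
  | some f =>
    refine (Finset.card_le_card_of_injOn (t := Finset.range 2 ×ˢ Finset.range 2)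
      (fun q => q.elim (0, 0) fun d => (d.col % 2, d.row % 2)) ?_ ?_).trans (by simp)
    · intro q _
      match q with
      | none => simp
      | some d =>
        simp
        omega
    · intro q hq q' hq' h
      have hq := (Finset.mem_filter.1 (Finset.mem_coe.1 hq)).2
      have hq' := (Finset.mem_filter.1 (Finset.mem_coe.1 hq')).2
      match q, q', hq, hq', h with
      | some d, some e, hd, he, h =>
        obtain ⟨hd1, hd2, hd3, hd4⟩ := hd
        obtain ⟨he1, he2, he3, he4⟩ := he
        obtain ⟨h1, h2⟩ := Prod.mk.inj h
        exact congrArg some (DetailIndex.ext' (by omega) (by omega) (by omega)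
          (hd4.symm.trans he4))

open Classical in
/-- The rooted subtrees of the wavelet tree with at most `K` vertices. -/
noncomputable def rootedSubtrees (l K : ℕ) : Finset (Finset (WaveletIndex l)) :=
  Finset.univ.filter fun S => IsRootedSubtree S ∧ S.card ≤ K

theorem mem_rootedSubtrees {l K : ℕ} {S : Finset (WaveletIndex l)} :
    S ∈ rootedSubtrees l K ↔ IsRootedSubtree S ∧ S.card ≤ K := by
  simp [rootedSubtrees]

theorem card_rootedSubtrees_le (l K : ℕ) : (rootedSubtrees l K).card ≤ 32 ^ K :=
  card_rooted_subtrees_le IsParent none WaveletIndex.depth (fun _ _ => IsParent.depth_lt)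
    exists_isParent card_children_le K _ (fun _ hS => (mem_rootedSubtrees.1 hS).1.1)
    (fun _ hS => (mem_rootedSubtrees.1 hS).1.2) fun _ hS => (mem_rootedSubtrees.1 hS).2

theorem IsRootedSubtree.union {l : ℕ} [DecidableEq (WaveletIndex l)]
    {S T : Finset (WaveletIndex l)} (hS : IsRootedSubtree S) (hT : IsRootedSubtree T) :
    IsRootedSubtree (S ∪ T) := by
  refine ⟨Finset.mem_union_left _ hS.1, fun p q hpq hq => ?_⟩
  rcases Finset.mem_union.1 hq with h | h
  · exact Finset.mem_union_left _ (hS.2 p q hpq h)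
  · exact Finset.mem_union_right _ (hT.2 p q hpq h)

/-! ### Completeness of the Haar system -/

theorem DetailIndex.depth_add_level {l : ℕ} (d : DetailIndex l) : d.1.val + d.level = l := by
  have := d.1.isLt
  unfold DetailIndex.level
  omega

theorem div_two_pow_lt {l j a : ℕ} (hj : j ≤ l) (ha : a < 2 ^ l) : a / 2 ^ (l - j) < 2 ^ j := by
  rw [Nat.div_lt_iff_lt_mul (by positivity), ← pow_add, Nat.add_sub_cancel' hj]
  exact ha

/-- The cell of depth `j` that contains the pixel `p`. -/
def cellAt {l : ℕ} (j : Fin l) (p : Pixel l) : Fin (2 ^ j.val) × Fin (2 ^ j.val) :=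
  (⟨p.1.val / 2 ^ (l - j.val), div_two_pow_lt j.isLt.le p.1.isLt⟩,
    ⟨p.2.val / 2 ^ (l - j.val), div_two_pow_lt j.isLt.le p.2.isLt⟩)

theorem covers_mk_iff {l : ℕ} (j : Fin l) (c : Fin (2 ^ j.val) × Fin (2 ^ j.val)) (o : Fin 3)
    (p : Pixel l) : DetailIndex.Covers (⟨j, c, o⟩ : DetailIndex l) p ↔ c = cellAt j p := by
  rw [Prod.ext_iff, Fin.ext_iff, Fin.ext_iff]
  exact ⟨fun h => ⟨h.1.symm, h.2.symm⟩, fun h => ⟨h.1.symm, h.2.symm⟩⟩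

open Classical in
theorem sum_ite_covers {l : ℕ} (p : Pixel l) (F : DetailIndex l → ℝ) :
    ∑ d : DetailIndex l, (if d.Covers p then F d else 0) =
      ∑ j : Fin l, ∑ o : Fin 3, F ⟨j, cellAt j p, o⟩ := by
  rw [Fintype.sum_sigma]
  refine Finset.sum_congr rfl fun j _ => ?_
  rw [Fintype.sum_prod_type]
  rw [Finset.sum_eq_single (cellAt j p)]
  · refine Finset.sum_congr rfl fun o _ => ?_
    rw [if_pos ((covers_mk_iff j _ o p).2 rfl)]
  · intro c _ hc
    refine Finset.sum_eq_zero fun o _ => ?_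
    rw [if_neg fun h => hc ((covers_mk_iff j c o p).1 h)]
  · intro h
    exact absurd (Finset.mem_univ _) h

theorem neg_one_pow_mul_of_div_two_eq {u v : ℕ} (h : u / 2 = v / 2) :
    (-1 : ℝ) ^ u * (-1) ^ v = if u = v then 1 else -1 := by
  split_ifs with huv
  · rw [huv, ← pow_add, Even.neg_one_pow ⟨v, rfl⟩]
  · rw [← pow_add, Odd.neg_one_pow]
    rw [Nat.odd_iff]
    omega

/-- The kernel of the orthogonal projection to the functions that are constant on the cells of
level `i`. -/
noncomputable def cellKernel {l : ℕ} (p q : Pixel l) (i : ℕ) : ℝ :=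
  if p.1.val / 2 ^ i = q.1.val / 2 ^ i ∧ p.2.val / 2 ^ i = q.2.val / 2 ^ i then (4 ^ i)⁻¹ else 0

/-- The three orientations at level `i + 1` add up to the difference of two consecutive
projection kernels. -/
theorem sum_orient_eq_cellKernel_sub {l : ℕ} (p q : Pixel l) (i : ℕ)
    (h : p.1.val / 2 ^ (i + 1) = q.1.val / 2 ^ (i + 1) ∧
      p.2.val / 2 ^ (i + 1) = q.2.val / 2 ^ (i + 1)) :
    ((-1 : ℝ) ^ (p.1.val / 2 ^ i) * (-1) ^ (q.1.val / 2 ^ i) +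
      (-1 : ℝ) ^ (p.2.val / 2 ^ i) * (-1) ^ (q.2.val / 2 ^ i) +
      ((-1 : ℝ) ^ (p.1.val / 2 ^ i) * (-1) ^ (q.1.val / 2 ^ i)) *
        ((-1 : ℝ) ^ (p.2.val / 2 ^ i) * (-1) ^ (q.2.val / 2 ^ i))) * (4 ^ (i + 1))⁻¹ =
      cellKernel p q i - cellKernel p q (i + 1) := by
  unfold cellKernel
  rw [if_pos h]
  obtain ⟨h1, h2⟩ := h
  rw [pow_succ, ← Nat.div_div_eq_div_mul, ← Nat.div_div_eq_div_mul] at h1 h2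
  rw [neg_one_pow_mul_of_div_two_eq h1, neg_one_pow_mul_of_div_two_eq h2]
  by_cases hu : p.1.val / 2 ^ i = q.1.val / 2 ^ i <;>
    by_cases hv : p.2.val / 2 ^ i = q.2.val / 2 ^ i <;>
    simp only [hu, hv, if_true, if_false, and_self, and_false, false_and, pow_succ] <;>
    field_simp <;> norm_num

theorem cellKernel_eq_zero_of_succ {l : ℕ} (p q : Pixel l) (i : ℕ)
    (h : ¬ (p.1.val / 2 ^ (i + 1) = q.1.val / 2 ^ (i + 1) ∧
      p.2.val / 2 ^ (i + 1) = q.2.val / 2 ^ (i + 1))) : cellKernel p q i = 0 := by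
  unfold cellKernel
  rw [if_neg]
  rintro ⟨h1, h2⟩
  apply h
  rw [pow_succ, ← Nat.div_div_eq_div_mul, ← Nat.div_div_eq_div_mul, ← Nat.div_div_eq_div_mul,
    ← Nat.div_div_eq_div_mul, h1, h2]
  exact ⟨rfl, rfl⟩

/-- The wavelets of one level project to the functions constant on the cells of the next finer
level, modulo those constant on the cells of their own level. -/
theorem haarMatrix_level_sum {l : ℕ} (p q : Pixel l) (j : Fin l) :
    ∑ o : Fin 3, haarMatrix l (some ⟨j, cellAt j p, o⟩) p *
        haarMatrix l (some ⟨j, cellAt j p, o⟩) q =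
      cellKernel p q (l - (j.val + 1)) - cellKernel p q (l - j.val) := by
  classical
  obtain ⟨i, hi⟩ : ∃ i, l - j.val = i + 1 := ⟨l - j.val - 1, by have := j.isLt; omega⟩
  have hi' : l - (j.val + 1) = i := by omega
  have hlev : ∀ c o, DetailIndex.level (⟨j, c, o⟩ : DetailIndex l) = i + 1 := fun c o => hi
  have hcov : ∀ o, DetailIndex.Covers (⟨j, cellAt j p, o⟩ : DetailIndex l) q ↔
      (p.1.val / 2 ^ (i + 1) = q.1.val / 2 ^ (i + 1) ∧
        p.2.val / 2 ^ (i + 1) = q.2.val / 2 ^ (i + 1)) := by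
    intro o
    rw [covers_mk_iff, Prod.ext_iff, Fin.ext_iff, Fin.ext_iff, ← hi]
    exact Iff.rfl
  have hcovp : ∀ o, DetailIndex.Covers (⟨j, cellAt j p, o⟩ : DetailIndex l) p := fun o =>
    (covers_mk_iff j _ o p).2 rfl
  rw [hi', hi]
  simp only [haarMatrix, hcov, hcovp, if_true]
  by_cases h : (p.1.val / 2 ^ (i + 1) = q.1.val / 2 ^ (i + 1) ∧
      p.2.val / 2 ^ (i + 1) = q.2.val / 2 ^ (i + 1))
  · simp only [if_pos h]
    rw [← sum_orient_eq_cellKernel_sub p q i h, Fin.sum_univ_three]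
    simp only [DetailIndex.sign, DetailIndex.orient, hlev, Nat.add_sub_cancel]
    have h4 : ((4 : ℝ) ^ (i + 1))⁻¹ = ((2 : ℝ) ^ (i + 1))⁻¹ * ((2 : ℝ) ^ (i + 1))⁻¹ := by
      rw [← mul_inv, ← mul_pow]
      norm_num
    rw [h4]
    simp only [if_true, one_ne_zero, if_false, Fin.reduceEq, pow_add]
    ring
  · simp only [if_neg h, mul_zero, Finset.sum_const_zero]
    rw [cellKernel_eq_zero_of_succ p q i h, cellKernel, if_neg h, sub_zero]

/-- The completeness of the Haar system: the kernels of consecutive levels telescope. -/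
theorem haarMatrix_transpose_mul_self (l : ℕ) : (haarMatrix l).transpose * haarMatrix l = 1 := by
  classical
  ext p q
  rw [Matrix.mul_apply, Fintype.sum_option]
  simp only [Matrix.transpose_apply]
  have hd : ∀ d : DetailIndex l, haarMatrix l (some d) p * haarMatrix l (some d) q =
      if d.Covers p then haarMatrix l (some d) p * haarMatrix l (some d) q else 0 := by
    intro d
    split_ifs with h
    · rfl
    · simp [haarMatrix, h]
  rw [Finset.sum_congr rfl fun d _ => hd d,
    sum_ite_covers p fun d => haarMatrix l (some d) p * haarMatrix l (some d) q,
    Finset.sum_congr rfl fun j _ => haarMatrix_level_sum p q j,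
    Fin.sum_univ_eq_sum_range
      (fun j => cellKernel p q (l - (j + 1)) - cellKernel p q (l - j)) l,
    Finset.sum_range_sub (fun j => cellKernel p q (l - j)) l, Nat.sub_self, Nat.sub_zero]
  have htop : cellKernel p q l = ((4 : ℝ) ^ l)⁻¹ := by
    unfold cellKernel
    rw [if_pos]
    simp [Nat.div_eq_of_lt]
  have hbot : cellKernel p q 0 = (1 : Matrix (Pixel l) (Pixel l) ℝ) p q := by
    unfold cellKernel
    rw [Matrix.one_apply]
    simp only [pow_zero, Nat.div_one, inv_one, Prod.ext_iff, Fin.ext_iff]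
  have hconst : haarMatrix l none p * haarMatrix l none q = ((4 : ℝ) ^ l)⁻¹ := by
    simp only [haarMatrix]
    rw [← mul_inv, ← mul_pow]
    norm_num
  rw [htop, hbot, hconst]
  ring

theorem card_waveletIndex (l : ℕ) : Fintype.card (WaveletIndex l) = Fintype.card (Pixel l) := by
  have h : ∀ l : ℕ, ∑ j ∈ Finset.range l, 2 ^ j * 2 ^ j * 3 + 1 = 2 ^ l * 2 ^ l := by
    intro l
    induction l with
    | zero => simp
    | succ l ih => rw [Finset.sum_range_succ, pow_succ]; linarith
  rw [Fintype.card_option, Fintype.card_sigma]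
  simp only [Fintype.card_prod, Fintype.card_fin]
  rw [Fin.sum_univ_eq_sum_range (fun j => 2 ^ j * 2 ^ j * 3) l, h]

/-- A complete system with as many vectors as dimensions is orthonormal. -/
theorem haarMatrix_mul_transpose_self (l : ℕ) : haarMatrix l * (haarMatrix l).transpose = 1 :=
  (Matrix.mul_eq_one_comm_of_equiv (Fintype.equivOfCardEq (card_waveletIndex l).symm)).1
    (haarMatrix_transpose_mul_self l)

theorem sum_haarMatrix_mul (l : ℕ) (v w : WaveletIndex l) :
    ∑ p, haarMatrix l v p * haarMatrix l w p = if v = w then 1 else 0 := by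
  have h := congrFun (congrFun (haarMatrix_mul_transpose_self l) v) w
  rw [Matrix.mul_apply, Matrix.one_apply] at h
  exact h

theorem sum_haarMatrix_detail (l : ℕ) (d : DetailIndex l) : ∑ p, haarMatrix l (some d) p = 0 := by
  have h := sum_haarMatrix_mul l none (some d)
  rw [if_neg (by simp)] at h
  have h' : ∑ p, haarMatrix l none p * haarMatrix l (some d) p =
      ((2 : ℝ) ^ l)⁻¹ * ∑ p, haarMatrix l (some d) p := by
    rw [Finset.mul_sum]
    rfl
  rw [h'] at h
  exact (mul_eq_zero.1 h).resolve_left (by positivity)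

theorem DetailIndex.abs_sign {l : ℕ} (d : DetailIndex l) (p : Pixel l) : |d.sign p| = 1 := by
  simp only [DetailIndex.sign]
  split_ifs <;> simp

/-- All nonzero entries of a Haar vector have the same modulus, so its `ℓ₁` norm follows from its
`ℓ₂` norm. -/
theorem sum_abs_haarMatrix_detail (l : ℕ) (d : DetailIndex l) :
    ∑ p, |haarMatrix l (some d) p| = 2 ^ d.level := by
  have h := sum_haarMatrix_mul l (some d) (some d)
  rw [if_pos rfl] at h
  have habs : ∀ p, |haarMatrix l (some d) p| =
      2 ^ d.level * (haarMatrix l (some d) p * haarMatrix l (some d) p) := by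
    intro p
    rw [← abs_mul_abs_self]
    simp only [haarMatrix]
    split_ifs
    · rw [abs_mul, d.abs_sign, one_mul, abs_of_pos (by positivity)]
      field_simp
    · simp
  rw [Finset.sum_congr rfl fun p _ => habs p, ← Finset.mul_sum, h, mul_one]

theorem sum_abs_haarMatrix_none (l : ℕ) : ∑ p, |haarMatrix l none p| = 2 ^ l := by
  simp only [haarMatrix]
  rw [Finset.sum_const, abs_of_pos (by positivity), Finset.card_univ, Fintype.card_prod,
    Fintype.card_fin, nsmul_eq_mul]
  push_cast
  field_simp

/-! ### The Earth-Mover norm -/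

theorem pixelDist_nonneg {l : ℕ} (p q : Pixel l) : 0 ≤ pixelDist p q := by
  unfold pixelDist; positivity

theorem pixelDist_self {l : ℕ} (p : Pixel l) : pixelDist p p = 0 := by simp [pixelDist]

theorem pixelDist_comm {l : ℕ} (p q : Pixel l) : pixelDist p q = pixelDist q p := by
  simp only [pixelDist, abs_sub_comm]

theorem pixelDist_triangle {l : ℕ} (p q r : Pixel l) :
    pixelDist p r ≤ pixelDist p q + pixelDist q r := by
  unfold pixelDist
  have h1 := abs_sub_le (p.1.val : ℝ) q.1.val r.1.val
  have h2 := abs_sub_le (p.2.val : ℝ) q.2.val r.2.val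
  linarith

theorem pixelDist_le {l : ℕ} (p q : Pixel l) : pixelDist p q ≤ 2 * 2 ^ l := by
  have h : ∀ a b : Fin (2 ^ l), |(a.val : ℝ) - b.val| ≤ 2 ^ l := by
    intro a b
    have ha : (a.val : ℝ) < 2 ^ l := by exact_mod_cast a.isLt
    have hb : (b.val : ℝ) < 2 ^ l := by exact_mod_cast b.isLt
    rw [abs_le]
    constructor <;> linarith [(Nat.cast_nonneg a.val : (0 : ℝ) ≤ _),
      (Nat.cast_nonneg b.val : (0 : ℝ) ≤ _)]
  unfold pixelDist
  linarith [h p.1 q.1, h p.2 q.2]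

theorem l1Norm_nonneg {ι : Type*} [Fintype ι] (x : ι → ℝ) : 0 ≤ l1Norm x :=
  Finset.sum_nonneg fun _ _ => abs_nonneg _

theorem l1Norm_add_le {ι : Type*} [Fintype ι] (x y : ι → ℝ) :
    l1Norm (x + y) ≤ l1Norm x + l1Norm y := by
  unfold l1Norm
  rw [← Finset.sum_add_distrib]
  exact Finset.sum_le_sum fun i _ => abs_add_le _ _

theorem l1Norm_of_nonneg {ι : Type*} [Fintype ι] {x : ι → ℝ} (hx : 0 ≤ x) :
    l1Norm x = ∑ i, x i :=
  Finset.sum_congr rfl fun i _ => abs_of_nonneg (hx i)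

theorem flowCost_nonneg {l : ℕ} {γ : Pixel l → Pixel l → ℝ} (hγ : ∀ i j, 0 ≤ γ i j) :
    0 ≤ flowCost γ :=
  Finset.sum_nonneg fun i _ => Finset.sum_nonneg fun j _ =>
    mul_nonneg (hγ i j) (pixelDist_nonneg i j)

theorem flowCost_flows_bddBelow {l : ℕ} (x y : Pixel l → ℝ) :
    BddBelow (flowCost '' flows x y) :=
  ⟨0, by rintro _ ⟨γ, hγ, rfl⟩; exact flowCost_nonneg hγ.1⟩

theorem emdStar_nonneg {l : ℕ} (x y : Pixel l → ℝ) : 0 ≤ emdStar x y :=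
  Real.sInf_nonneg (by rintro _ ⟨γ, hγ, rfl⟩; exact flowCost_nonneg hγ.1)

/-- `w` is the divergence of a nonnegative flow plus a remainder, of total charge at most `r`. -/
def EmdLE {l : ℕ} (w : Pixel l → ℝ) (r : ℝ) : Prop :=
  ∃ (γ : Pixel l → Pixel l → ℝ) (z : Pixel l → ℝ), (∀ i j, 0 ≤ γ i j) ∧
    (∀ p, w p = ∑ j, γ p j - ∑ i, γ i p + z p) ∧ flowCost γ + 2 * 2 ^ l * l1Norm z ≤ r

theorem EmdLE.emdNorm_le {l : ℕ} {w : Pixel l → ℝ} {r : ℝ} (h : EmdLE w r) : emdNorm w ≤ r := by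
  obtain ⟨γ, z, hγ, hw, hr⟩ := h
  have hx : (0 : Pixel l → ℝ) ≤ fun p => ∑ j, γ p j := fun p =>
    Finset.sum_nonneg fun j _ => hγ p j
  have hy : (0 : Pixel l → ℝ) ≤ fun p => ∑ i, γ i p := fun p =>
    Finset.sum_nonneg fun i _ => hγ i p
  have hle : emdNorm w ≤
      emdStar (fun p => ∑ j, γ p j) (fun p => ∑ i, γ i p) + 2 * 2 ^ l * l1Norm z := by
    refine csInf_le ⟨0, ?_⟩ ⟨_, _, z, ?_, ?_, hx, hy, rfl⟩
    · rintro _ ⟨x, y, z, -, -, -, -, rfl⟩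
      have := emdStar_nonneg x y
      have := l1Norm_nonneg z
      positivity
    · funext p
      exact (hw p).symm
    · rw [l1Norm_of_nonneg hx, l1Norm_of_nonneg hy]
      exact Finset.sum_comm
  have hstar : emdStar (fun p => ∑ j, γ p j) (fun p => ∑ i, γ i p) ≤ flowCost γ :=
    csInf_le (flowCost_flows_bddBelow _ _) ⟨γ, ⟨hγ, fun _ => rfl, fun _ => rfl⟩, rfl⟩
  linarith

theorem EmdLE.add {l : ℕ} {w w' : Pixel l → ℝ} {r r' : ℝ} (h : EmdLE w r) (h' : EmdLE w' r') :
    EmdLE (w + w') (r + r') := by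
  obtain ⟨γ, z, hγ, hw, hr⟩ := h
  obtain ⟨γ', z', hγ', hw', hr'⟩ := h'
  refine ⟨fun i j => γ i j + γ' i j, z + z', fun i j => add_nonneg (hγ i j) (hγ' i j),
    fun p => ?_, ?_⟩
  · simp only [Pi.add_apply, Finset.sum_add_distrib]
    rw [hw p, hw' p]
    ring
  · have h1 : flowCost (fun i j => γ i j + γ' i j) = flowCost γ + flowCost γ' := by
      simp only [flowCost, add_mul, Finset.sum_add_distrib]
    have h2 : 2 * (2 : ℝ) ^ l * l1Norm (z + z') ≤ 2 * 2 ^ l * (l1Norm z + l1Norm z') := by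
      gcongr
      exact l1Norm_add_le z z'
    rw [h1]
    linarith

theorem EmdLE.mono {l : ℕ} {w : Pixel l → ℝ} {r r' : ℝ} (h : EmdLE w r) (hr : r ≤ r') :
    EmdLE w r' := by
  obtain ⟨γ, z, hγ, hw, hr₁⟩ := h
  exact ⟨γ, z, hγ, hw, hr₁.trans hr⟩

theorem emdLE_self {l : ℕ} (w : Pixel l → ℝ) : EmdLE w (2 * 2 ^ l * l1Norm w) :=
  ⟨fun _ _ => 0, w, fun _ _ => le_rfl, by simp, by simp [flowCost]⟩

theorem EmdLE.sum {l : ℕ} {κ : Type*} (s : Finset κ) (w : κ → Pixel l → ℝ) (r : κ → ℝ)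
    (h : ∀ k ∈ s, EmdLE (w k) (r k)) : EmdLE (∑ k ∈ s, w k) (∑ k ∈ s, r k) := by
  classical
  induction s using Finset.induction_on with
  | empty => exact (emdLE_self 0).mono (by simp [l1Norm])
  | insert a s ha ih =>
    rw [Finset.sum_insert ha, Finset.sum_insert ha]
    exact (h a (Finset.mem_insert_self a s)).add
      (ih fun k hk => h k (Finset.mem_insert_of_mem hk))

theorem emdLE_dipole_of_nonneg {l : ℕ} [DecidableEq (Pixel l)] (a : ℝ) (ha : 0 ≤ a)
    (p q : Pixel l) : EmdLE (a • (Pi.single p 1 - Pi.single q 1)) (a * pixelDist p q) := by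
  refine ⟨fun i j => if i = p ∧ j = q then a else 0, 0, fun i j => ?_, fun s => ?_, ?_⟩
  · dsimp only
    split_ifs
    · exact ha
    · exact le_rfl
  · have h1 : ∑ j, (if s = p ∧ j = q then a else 0) = a * (Pi.single p 1 : Pixel l → ℝ) s := by
      by_cases hs : s = p <;> simp [hs]
    have h2 : ∑ i, (if i = p ∧ s = q then a else 0) = a * (Pi.single q 1 : Pixel l → ℝ) s := by
      by_cases hs : s = q <;> simp [hs]
    rw [h1, h2]
    simp only [Pi.smul_apply, Pi.sub_apply, smul_eq_mul, Pi.zero_apply]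
    ring
  · have : flowCost (fun i j => if i = p ∧ j = q then a else 0) = a * pixelDist p q := by
      unfold flowCost
      rw [Finset.sum_eq_single p, Finset.sum_eq_single q]
      · simp
      · intro j _ hj
        simp [hj]
      · simp
      · intro i _ hi
        simp [hi]
      · simp
    rw [this]
    simp [l1Norm]

theorem emdLE_dipole {l : ℕ} [DecidableEq (Pixel l)] (a : ℝ) (p q : Pixel l) :
    EmdLE (a • (Pi.single p 1 - Pi.single q 1)) (|a| * pixelDist p q) := by
  rcases le_total 0 a with ha | ha
  · rw [abs_of_nonneg ha]
    exact emdLE_dipole_of_nonneg a ha p q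
  · rw [abs_of_nonpos ha, pixelDist_comm]
    have := emdLE_dipole_of_nonneg (-a) (by linarith) q p
    rwa [neg_smul, ← smul_neg, neg_sub] at this

/-- A vector of total mass zero can be balanced by moving all its mass to one pixel. -/
theorem emdLE_of_sum_eq_zero {l : ℕ} (w : Pixel l → ℝ) (hw : ∑ p, w p = 0) (q : Pixel l) (R : ℝ)
    (hR : ∀ p, w p ≠ 0 → pixelDist p q ≤ R) : EmdLE w (R * l1Norm w) := by
  classical
  have h := EmdLE.sum Finset.univ (fun p => w p • ((Pi.single p 1 : Pixel l → ℝ) - Pi.single q 1))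
    (fun p => |w p| * pixelDist p q) fun p _ => emdLE_dipole (w p) p q
  have e : ∑ p, w p • ((Pi.single p 1 : Pixel l → ℝ) - Pi.single q 1) = w := by
    simp only [smul_sub, Finset.sum_sub_distrib]
    rw [← Finset.sum_smul, hw, zero_smul, sub_zero]
    funext s
    simp [Finset.sum_apply, Pi.single_apply]
  rw [e] at h
  refine h.mono ?_
  unfold l1Norm
  rw [Finset.mul_sum]
  refine Finset.sum_le_sum fun p _ => ?_
  by_cases hp : w p = 0
  · simp [hp]
  · rw [mul_comm]
    exact mul_le_mul_of_nonneg_right (hR p hp) (abs_nonneg _)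

/-- The inverse of the rescaled Haar transform. -/
noncomputable def haarSynth {l : ℕ} (c : WaveletIndex l → ℝ) : Pixel l → ℝ :=
  ∑ v, (c v / haarScale l v) • haarMatrix l v

theorem haarScale_pos {l : ℕ} (v : WaveletIndex l) : 0 < haarScale l v := by
  cases v <;> simp only [haarScale] <;> positivity

theorem rescaledHaar_mulVec {l : ℕ} (x : Pixel l → ℝ) (v : WaveletIndex l) :
    (rescaledHaar l).mulVec x v = haarScale l v * (haarMatrix l).mulVec x v := by
  rw [rescaledHaar, ← Matrix.mulVec_mulVec, Matrix.mulVec_diagonal]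

theorem haarSynth_rescaledHaar {l : ℕ} (x : Pixel l → ℝ) :
    haarSynth ((rescaledHaar l).mulVec x) = x := by
  have h : (haarMatrix l).transpose.mulVec ((haarMatrix l).mulVec x) = x := by
    rw [Matrix.mulVec_mulVec, haarMatrix_transpose_mul_self, Matrix.one_mulVec]
  funext p
  have hp := congrFun h p
  rw [haarSynth, Finset.sum_apply]
  rw [Matrix.mulVec, dotProduct] at hp
  rw [← hp]
  refine Finset.sum_congr rfl fun v _ => ?_
  rw [rescaledHaar_mulVec, mul_div_cancel_left₀ _ (haarScale_pos v).ne', Pi.smul_apply, smul_eq_mul,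
    Matrix.transpose_apply, mul_comm]

theorem haarSynth_sub {l : ℕ} (c c' : WaveletIndex l → ℝ) :
    haarSynth (c - c') = haarSynth c - haarSynth c' := by
  unfold haarSynth
  rw [← Finset.sum_sub_distrib]
  refine Finset.sum_congr rfl fun v _ => ?_
  rw [Pi.sub_apply, sub_div, sub_smul]

theorem l1Norm_smul {ι : Type*} [Fintype ι] (a : ℝ) (x : ι → ℝ) :
    l1Norm (a • x) = |a| * l1Norm x := by
  simp only [l1Norm, Pi.smul_apply, smul_eq_mul, abs_mul, Finset.mul_sum]

theorem abs_sub_div_mul_le (a b N : ℕ) (hN : 0 < N) (h : a / N = b) :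
    |(a : ℝ) - ((b * N : ℕ) : ℝ)| ≤ N := by
  have h1 : b * N ≤ a := h ▸ Nat.div_mul_le_self a N
  have h2 : a < b * N + N := by
    have := Nat.lt_div_mul_add (a := a) hN
    rwa [h] at this
  have h1' : ((b * N : ℕ) : ℝ) ≤ a := by exact_mod_cast h1
  have h2' : (a : ℝ) < ((b * N : ℕ) : ℝ) + N := by exact_mod_cast h2
  rw [abs_le]
  constructor <;> linarith

/-- The upper left pixel of the cell of a wavelet. -/
def DetailIndex.corner {l : ℕ} (d : DetailIndex l) : Pixel l :=
  have h : 2 ^ l = 2 ^ d.1.val * 2 ^ d.level := by rw [← pow_add, d.depth_add_level]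
  (⟨d.col * 2 ^ d.level, by
      rw [h]; exact Nat.mul_lt_mul_of_pos_right d.col_lt (by positivity)⟩,
    ⟨d.row * 2 ^ d.level, by
      rw [h]; exact Nat.mul_lt_mul_of_pos_right d.row_lt (by positivity)⟩)

theorem DetailIndex.Covers.pixelDist_corner_le {l : ℕ} {d : DetailIndex l} {p : Pixel l}
    (h : d.Covers p) : pixelDist p d.corner ≤ 2 * 2 ^ d.level := by
  have h1 := abs_sub_div_mul_le _ _ _ (by positivity) h.1
  have h2 := abs_sub_div_mul_le _ _ _ (by positivity) h.2
  unfold pixelDist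
  change |_ - ((d.col * 2 ^ d.level : ℕ) : ℝ)| + |_ - ((d.row * 2 ^ d.level : ℕ) : ℝ)| ≤ _
  push_cast at h1 h2 ⊢
  linarith

/-- Up to a constant factor, the Earth-Mover norm is dominated by the `ℓ₁` norm of the rescaled
Haar coefficients: each wavelet has mass zero on its cell. -/
theorem emdNorm_haarSynth_le {l : ℕ} (c : WaveletIndex l → ℝ) :
    emdNorm (haarSynth c) ≤ 8 * l1Norm c := by
  apply EmdLE.emdNorm_le
  unfold l1Norm
  rw [Finset.mul_sum]
  refine EmdLE.sum Finset.univ _ _ fun v _ => ?_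
  cases v with
  | none =>
    refine (emdLE_self _).mono ?_
    rw [l1Norm_smul, abs_div, abs_of_pos (haarScale_pos _), l1Norm, sum_abs_haarMatrix_none]
    simp only [haarScale]
    have e : 2 * (2 : ℝ) ^ l * (|c none| / (2 * 4 ^ l) * 2 ^ l) = |c none| := by
      rw [show (4 : ℝ) = 2 * 2 by norm_num, mul_pow]
      field_simp
    rw [e]
    linarith [abs_nonneg (c none)]
  | some d =>
    refine (emdLE_of_sum_eq_zero _ ?_ d.corner (2 * 2 ^ d.level) fun p hp => ?_).mono ?_
    · simp only [Pi.smul_apply, smul_eq_mul]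
      rw [← Finset.mul_sum, sum_haarMatrix_detail, mul_zero]
    · refine DetailIndex.Covers.pixelDist_corner_le ?_
      by_contra hcov
      exact hp (by simp [haarMatrix, hcov])
    · rw [l1Norm_smul, abs_div, abs_of_pos (haarScale_pos _), l1Norm, sum_abs_haarMatrix_detail]
      simp only [haarScale]
      apply le_of_eq
      rw [show (4 : ℝ) ^ d.level = 2 ^ d.level * 2 ^ d.level by rw [← mul_pow]; norm_num]
      field_simp
      ring

/-- The product flow; without it the infimum defining `emdStar` would be over the empty set. -/
theorem flows_nonempty {l : ℕ} {x y : Pixel l → ℝ} (hx : 0 ≤ x) (hy : 0 ≤ y)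
    (hxy : l1Norm x = l1Norm y) : (flows x y).Nonempty := by
  rw [l1Norm_of_nonneg hx, l1Norm_of_nonneg hy] at hxy
  have hsum : 0 ≤ ∑ i, x i := Finset.sum_nonneg fun i _ => hx i
  refine ⟨fun i j => x i * y j / ∑ i, x i, fun i j => div_nonneg (mul_nonneg (hx i) (hy j)) hsum,
    fun i => ?_, fun j => ?_⟩
  · rw [← Finset.sum_div, ← Finset.mul_sum, ← hxy]
    by_cases h0 : ∑ i, x i = 0
    · rw [h0, (Finset.sum_eq_zero_iff_of_nonneg fun i _ => hx i).1 h0 i (Finset.mem_univ i)]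
      simp
    · exact mul_div_cancel_right₀ _ h0
  · rw [← Finset.sum_div, ← Finset.sum_mul]
    by_cases h0 : ∑ i, x i = 0
    · have h0' := hxy.symm.trans h0
      rw [h0, (Finset.sum_eq_zero_iff_of_nonneg fun i _ => hy i).1 h0' j (Finset.mem_univ j)]
      simp
    · exact mul_div_cancel_left₀ _ h0

/-- The easy half of Kantorovich duality. -/
theorem sum_mul_le_emdNorm {l : ℕ} (f : Pixel l → ℝ) (hlip : ∀ p q, f p - f q ≤ pixelDist p q)
    (hbound : ∀ p, |f p| ≤ 2 * 2 ^ l) (w : Pixel l → ℝ) : ∑ p, f p * w p ≤ emdNorm w := by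
  refine le_csInf ⟨_, 0, 0, w, by simp, rfl, le_rfl, le_rfl, rfl⟩ ?_
  rintro _ ⟨x, y, z, rfl, hxy, hx, hy, rfl⟩
  have hstar : ∑ p, f p * x p - ∑ p, f p * y p ≤ emdStar x y := by
    refine le_csInf ((flows_nonempty hx hy hxy).image _) ?_
    rintro _ ⟨γ, ⟨hγ, h1, h2⟩, rfl⟩
    have e1 : ∑ p, f p * x p = ∑ i, ∑ j, γ i j * f i :=
      Finset.sum_congr rfl fun i _ => by rw [← h1 i, ← Finset.sum_mul, mul_comm]
    have e2 : ∑ p, f p * y p = ∑ i, ∑ j, γ i j * f j := by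
      rw [Finset.sum_comm]
      exact Finset.sum_congr rfl fun j _ => by rw [← h2 j, ← Finset.sum_mul, mul_comm]
    rw [e1, e2, ← Finset.sum_sub_distrib]
    refine Finset.sum_le_sum fun i _ => ?_
    rw [← Finset.sum_sub_distrib]
    refine Finset.sum_le_sum fun j _ => ?_
    rw [← mul_sub]
    exact mul_le_mul_of_nonneg_left (hlip i j) (hγ i j)
  have hz : ∑ p, f p * z p ≤ 2 * 2 ^ l * l1Norm z := by
    unfold l1Norm
    rw [Finset.mul_sum]
    refine Finset.sum_le_sum fun p _ => (le_abs_self _).trans ?_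
    rw [abs_mul]
    exact mul_le_mul_of_nonneg_right (hbound p) (abs_nonneg _)
  have e : ∑ p, f p * (x - y + z) p =
      ∑ p, f p * x p - ∑ p, f p * y p + ∑ p, f p * z p := by
    rw [← Finset.sum_sub_distrib, ← Finset.sum_add_distrib]
    refine Finset.sum_congr rfl fun p _ => ?_
    simp only [Pi.add_apply, Pi.sub_apply]
    ring
  rw [e]
  linarith

/-! ### Trees around sparse sets -/

/-- The best approximation of a coefficient vector from the tree-sparse model, in the `ℓ₁` norm. -/
noncomputable def modelError {l : ℕ} (K : ℕ) (v : WaveletIndex l → ℝ) : ℝ :=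
  sInf ((fun y => l1Norm (v - y)) '' treeSparse l K)

theorem treeError_eq_modelError {l : ℕ} (K : ℕ) (x : Pixel l → ℝ) :
    treeError K x = modelError K ((rescaledHaar l).mulVec x) := rfl

theorem sum_compl_le_l1Norm_sub {ι : Type*} [Fintype ι] [DecidableEq ι] (S : Finset ι)
    (v y : ι → ℝ) (hy : Function.support y ⊆ (S : Set ι)) :
    ∑ i ∈ Sᶜ, |v i| ≤ l1Norm (v - y) := by
  have h : ∑ i ∈ Sᶜ, |v i| = ∑ i ∈ Sᶜ, |(v - y) i| := by
    refine Finset.sum_congr rfl fun i hi => ?_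
    have : y i = 0 := by
      by_contra h
      exact Finset.mem_compl.1 hi (Finset.mem_coe.1 (hy h))
    rw [Pi.sub_apply, this, sub_zero]
  rw [h]
  exact Finset.sum_le_sum_of_subset_of_nonneg (Finset.subset_univ _) fun _ _ _ => abs_nonneg _

theorem modelError_le {l K : ℕ} (v : WaveletIndex l → ℝ) {S : Finset (WaveletIndex l)}
    (hS : S ∈ rootedSubtrees l K) : modelError K v ≤ ∑ i ∈ Sᶜ, |v i| := by
  rw [mem_rootedSubtrees] at hS
  refine csInf_le ⟨0, by rintro _ ⟨y, -, rfl⟩; exact l1Norm_nonneg _⟩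
    ⟨fun i => if i ∈ S then v i else 0, ⟨S, hS.1, hS.2, fun i hi => ?_⟩, ?_⟩
  · by_contra h
    exact hi (if_neg h)
  · dsimp only [l1Norm]
    rw [← Finset.sum_add_sum_compl S]
    have h1 : ∑ i ∈ S, |(v - fun i => if i ∈ S then v i else 0) i| = 0 :=
      Finset.sum_eq_zero fun i hi => by simp [hi]
    have h2 : ∑ i ∈ Sᶜ, |(v - fun i => if i ∈ S then v i else 0) i| = ∑ i ∈ Sᶜ, |v i| :=
      Finset.sum_congr rfl fun i hi => by simp [Finset.mem_compl.1 hi]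
    rw [h1, h2, zero_add]

theorem isRootedSubtree_singleton (l : ℕ) : IsRootedSubtree ({none} : Finset (WaveletIndex l)) := by
  refine ⟨Finset.mem_singleton_self _, fun p q hpq hq => ?_⟩
  rw [Finset.mem_singleton] at hq
  subst hq
  cases p <;> exact hpq.elim

/-- The best tree-sparse approximation is attained, by restriction to one of the trees. -/
theorem exists_modelError_eq {l K : ℕ} (hK : 1 ≤ K) (v : WaveletIndex l → ℝ) :
    ∃ S ∈ rootedSubtrees l K, modelError K v = ∑ i ∈ Sᶜ, |v i| := by
  have hne : ({none} : Finset (WaveletIndex l)) ∈ rootedSubtrees l K :=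
    mem_rootedSubtrees.2 ⟨isRootedSubtree_singleton l, by simpa using hK⟩
  obtain ⟨S, hS, hmin⟩ := Finset.exists_min_image (rootedSubtrees l K)
    (fun S => ∑ i ∈ Sᶜ, |v i|) ⟨_, hne⟩
  refine ⟨S, hS, (modelError_le v hS).antisymm ?_⟩
  refine le_csInf ⟨_, 0, ⟨_, isRootedSubtree_singleton l, by simpa using hK, by simp⟩, rfl⟩ ?_
  rintro _ ⟨y, ⟨T, hT, hTK, hy⟩, rfl⟩
  exact (hmin T (mem_rootedSubtrees.2 ⟨hT, hTK⟩)).trans (sum_compl_le_l1Norm_sub T v y hy)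

/-- The cell of the wavelet `d` belongs to the `5 × 5` block of cells of the same level around the
cell of the pixel `p`. -/
def DetailIndex.Near {l : ℕ} (d : DetailIndex l) (p : Pixel l) : Prop :=
  (d.col ≤ p.1.val / 2 ^ d.level + 2 ∧ p.1.val / 2 ^ d.level ≤ d.col + 2) ∧
    d.row ≤ p.2.val / 2 ^ d.level + 2 ∧ p.2.val / 2 ^ d.level ≤ d.row + 2

theorem DetailIndex.Covers.near {l : ℕ} {d : DetailIndex l} {p : Pixel l} (h : d.Covers p) :
    d.Near p := by
  obtain ⟨h1, h2⟩ := h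
  unfold DetailIndex.Near
  omega

open Classical in
/-- The tree around a set `P` of at most `k` pixels: all wavelets of depth less than `log₄ k`, of
which there are at most `k`, and at every depth those near a point of `P`. -/
noncomputable def nearTree {l : ℕ} (k : ℕ) (P : Finset (Pixel l)) : Finset (WaveletIndex l) :=
  Finset.univ.filter fun v => ∀ d, v = some d → d.1.val < Nat.log 4 k ∨ ∃ p ∈ P, d.Near p

theorem some_mem_nearTree {l k : ℕ} {P : Finset (Pixel l)} {d : DetailIndex l} :
    some d ∈ nearTree k P ↔ d.1.val < Nat.log 4 k ∨ ∃ p ∈ P, d.Near p := by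
  simp [nearTree]

theorem isRootedSubtree_nearTree {l : ℕ} (k : ℕ) (P : Finset (Pixel l)) :
    IsRootedSubtree (nearTree k P) := by
  have hnone : none ∈ nearTree k P := by simp [nearTree]
  refine ⟨hnone, fun p q hpq hq => ?_⟩
  match p, q, hpq, hq with
  | none, some d, _, _ => exact hnone
  | some e, some d, hpq, hq =>
    obtain ⟨hj, hc, hr, -⟩ := hpq
    rw [some_mem_nearTree] at hq ⊢
    rcases hq with hq | ⟨p, hp, hnear⟩
    · left
      omega
    · right
      refine ⟨p, hp, ?_⟩
      have hlev : e.level = d.level + 1 := by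
        have h1 := e.depth_add_level
        have h2 := d.depth_add_level
        omega
      unfold DetailIndex.Near at hnear ⊢
      rw [hlev, pow_succ, ← Nat.div_div_eq_div_mul, ← Nat.div_div_eq_div_mul]
      omega

open Classical in
theorem card_near_le {l : ℕ} (j₀ : ℕ) (p : Pixel l) :
    (Finset.univ.filter fun d : DetailIndex l => j₀ ≤ d.1.val ∧ d.Near p).card ≤
      75 * (l - j₀) := by
  refine (Finset.card_le_card_of_injOn
    (t := Finset.Ico j₀ l ×ˢ (Finset.range 5 ×ˢ Finset.range 5) ×ˢ (Finset.univ : Finset (Fin 3)))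
    (fun d => (d.1.val, (d.col + 2 - p.1.val / 2 ^ d.level, d.row + 2 - p.2.val / 2 ^ d.level),
      d.orient)) ?_ ?_).trans ?_
  · intro d hd
    obtain ⟨hj, hnear⟩ := (Finset.mem_filter.1 (Finset.mem_coe.1 hd)).2
    unfold DetailIndex.Near at hnear
    have := d.1.isLt
    simp only [Finset.coe_product, Set.mem_prod, Finset.mem_coe, Finset.mem_Ico, Finset.mem_range,
      Finset.mem_univ, and_true]
    omega
  · intro d hd e he h
    have hd := (Finset.mem_filter.1 (Finset.mem_coe.1 hd)).2.2
    have he := (Finset.mem_filter.1 (Finset.mem_coe.1 he)).2.2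
    simp only [Prod.mk.injEq] at h
    obtain ⟨hj, ⟨hc, hr⟩, ho⟩ := h
    have hlev : d.level = e.level := by
      have h1 := e.depth_add_level
      have h2 := d.depth_add_level
      omega
    unfold DetailIndex.Near at hd he
    rw [hlev] at hd hc hr
    exact DetailIndex.ext' hj (by omega) (by omega) ho
  · simp only [Finset.card_product, Nat.card_Ico, Finset.card_range, Finset.card_univ,
      Fintype.card_fin]
    omega

theorem card_nearTree_le {l : ℕ} (k : ℕ) (hk : Nat.log 4 k ≤ l) (P : Finset (Pixel l)) :
    (nearTree k P).card ≤ 4 ^ Nat.log 4 k + P.card * (75 * (l - Nat.log 4 k)) := by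
  classical
  set j₀ := Nat.log 4 k with hj₀
  set up : WaveletIndex j₀ → WaveletIndex l :=
    Option.map fun d => ⟨⟨d.1.val, d.1.isLt.trans_le hk⟩, d.2⟩ with hup
  have hsub : nearTree k P ⊆ Finset.univ.image up ∪ P.biUnion fun p =>
      (Finset.univ.filter fun d : DetailIndex l => j₀ ≤ d.1.val ∧ d.Near p).image some := by
    intro v hv
    rw [Finset.mem_union]
    match v, hv with
    | none, _ => exact Or.inl (Finset.mem_image.2 ⟨none, Finset.mem_univ _, rfl⟩)
    | some d, hv =>
      by_cases hd : d.1.val < j₀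
      · exact Or.inl (Finset.mem_image.2 ⟨some ⟨⟨d.1.val, hd⟩, d.2⟩, Finset.mem_univ _, rfl⟩)
      · obtain ⟨p, hp, hnear⟩ := (some_mem_nearTree.1 hv).resolve_left hd
        exact Or.inr (Finset.mem_biUnion.2 ⟨p, hp, Finset.mem_image.2
          ⟨d, Finset.mem_filter.2 ⟨Finset.mem_univ _, not_lt.1 hd, hnear⟩, rfl⟩⟩)
  refine (Finset.card_le_card hsub).trans ((Finset.card_union_le _ _).trans (add_le_add ?_ ?_))
  · refine Finset.card_image_le.trans_eq ?_
    rw [Finset.card_univ, card_waveletIndex, Fintype.card_prod, Fintype.card_fin, ← mul_pow]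
    norm_num
  · exact Finset.card_biUnion_le_card_mul _ _ _ fun p _ =>
      Finset.card_image_le.trans (card_near_le j₀ p)

theorem half_le_log_ratio {l k : ℕ} (hk : 1 ≤ k) (hkl : 2 * k < 4 ^ l) :
    1 / 2 ≤ Real.log ((4 : ℝ) ^ l / k) := by
  have hk0 : (0 : ℝ) < k := by exact_mod_cast hk
  have h : (2 : ℝ) ≤ 4 ^ l / k := by
    rw [le_div_iff₀ hk0]
    exact_mod_cast hkl.le
  have := Real.log_le_log (by norm_num) h
  linarith [Real.log_two_gt_d9]

/-- At most `k` vertices of small depth, and `75 k` vertices at each of the remaining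
`l - log₄ k ≤ 1 + log (n / k)` depths. -/
theorem card_nearTree_le_log {l k : ℕ} (hk : 1 ≤ k) (hkl : 2 * k < 4 ^ l) (P : Finset (Pixel l))
    (hP : P.card ≤ k) :
    ((nearTree k P).card : ℝ) ≤ 227 * (k * Real.log ((4 : ℝ) ^ l / k)) := by
  have hk0 : (0 : ℝ) < k := by exact_mod_cast hk
  set j₀ := Nat.log 4 k with hj₀
  set L := Real.log ((4 : ℝ) ^ l / k) with hL
  have hLhalf : 1 / 2 ≤ L := half_le_log_ratio hk hkl
  have hlow : 4 ^ j₀ ≤ k := Nat.pow_log_le_self 4 (by omega)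
  have hup : k < 4 ^ (j₀ + 1) := Nat.lt_pow_succ_log_self (by norm_num) k
  have hj₀l : j₀ ≤ l := by
    by_contra! h
    have := Nat.pow_lt_pow_right (by norm_num : 1 < 4) h
    omega
  have hlev : ((l - j₀ : ℕ) : ℝ) ≤ 1 + L := by
    have h1 : (4 : ℝ) ^ (l - j₀) ≤ 4 * (4 ^ l / k) := by
      have hup' : (k : ℝ) ≤ 4 ^ j₀ * 4 := by
        rw [← pow_succ]
        exact_mod_cast hup.le
      rw [← mul_div_assoc, le_div_iff₀ hk0]
      calc (4 : ℝ) ^ (l - j₀) * k ≤ 4 ^ (l - j₀) * (4 ^ j₀ * 4) := by gcongr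
        _ = 4 * 4 ^ l := by
          rw [← mul_assoc, ← pow_add, Nat.sub_add_cancel hj₀l, mul_comm]
    have h2 := Real.log_le_log (by positivity) h1
    have h4 : 1 ≤ Real.log 4 := by
      rw [show (4 : ℝ) = 2 ^ 2 by norm_num, Real.log_pow]
      push_cast
      linarith [Real.log_two_gt_d9]
    rw [Real.log_pow, Real.log_mul (by norm_num) (by positivity)] at h2
    by_contra! hcon
    nlinarith
  have hcard : ((nearTree k P).card : ℝ) ≤ 4 ^ j₀ + P.card * (75 * ((l - j₀ : ℕ) : ℝ)) := by
    exact_mod_cast card_nearTree_le k hj₀l P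
  have hlow' : (4 : ℝ) ^ j₀ ≤ k := by exact_mod_cast hlow
  have hP' : (P.card : ℝ) ≤ k := by exact_mod_cast hP
  calc ((nearTree k P).card : ℝ) ≤ k + k * (75 * (1 + L)) := by
        refine hcard.trans ?_
        gcongr
    _ ≤ 227 * (k * L) := by nlinarith

theorem add_le_of_div_add_lt {a b N : ℕ} (hN : 0 < N) (h : b / N + 2 < a / N) :
    b + 2 * N ≤ a := by
  have h1 : (b / N + 3) * N ≤ a := (Nat.mul_le_mul_right N h).trans (Nat.div_mul_le_self a N)
  have h2 := Nat.lt_div_mul_add (a := b) hN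
  nlinarith

/-- A pixel whose cell at some level is not near `p` is far from `p`. -/
theorem DetailIndex.Covers.le_pixelDist {l : ℕ} {d : DetailIndex l} {p q : Pixel l}
    (h : d.Covers q) (hp : ¬ d.Near p) : 2 * 2 ^ d.level ≤ pixelDist p q := by
  have hN : 0 < 2 ^ d.level := by positivity
  have hfar : ∀ a b : ℕ, b / 2 ^ d.level + 2 < a / 2 ^ d.level →
      2 * (2 : ℝ) ^ d.level ≤ (a : ℝ) - b := by
    intro a b hab
    have := add_le_of_div_add_lt hN hab
    have h' : (b : ℝ) + 2 * 2 ^ d.level ≤ a := by exact_mod_cast this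
    linarith
  have hcases : p.1.val / 2 ^ d.level + 2 < q.1.val / 2 ^ d.level ∨
      q.1.val / 2 ^ d.level + 2 < p.1.val / 2 ^ d.level ∨
      p.2.val / 2 ^ d.level + 2 < q.2.val / 2 ^ d.level ∨
      q.2.val / 2 ^ d.level + 2 < p.2.val / 2 ^ d.level := by
    by_contra! hcon
    apply hp
    obtain ⟨h1, h2⟩ := h
    unfold DetailIndex.Near
    omega
  have hx := abs_nonneg ((p.1.val : ℝ) - q.1.val)
  have hy := abs_nonneg ((p.2.val : ℝ) - q.2.val)
  unfold pixelDist
  rcases hcases with h | h | h | h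
  · linarith [hfar _ _ h, neg_abs_le ((p.1.val : ℝ) - q.1.val)]
  · linarith [hfar _ _ h, le_abs_self ((p.1.val : ℝ) - q.1.val)]
  · linarith [hfar _ _ h, neg_abs_le ((p.2.val : ℝ) - q.2.val)]
  · linarith [hfar _ _ h, le_abs_self ((p.2.val : ℝ) - q.2.val)]

/-- The second bound is needed for the induction: it covers the case in which all levels count. -/
theorem sum_dyadic_le (l : ℕ) (D : ℝ) (hD : 0 ≤ D) :
    ∑ j ∈ Finset.range l, (if 2 * (2 : ℝ) ^ (l - j) ≤ D then (2 : ℝ) ^ (l - j) else 0) ≤ D ∧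
    ∑ j ∈ Finset.range l, (if 2 * (2 : ℝ) ^ (l - j) ≤ D then (2 : ℝ) ^ (l - j) else 0) ≤
      2 * 2 ^ l := by
  induction l with
  | zero => simpa using hD
  | succ l ih =>
    rw [Finset.sum_range_succ']
    simp only [Nat.add_sub_add_right, Nat.sub_zero]
    have h2 : (0 : ℝ) < 2 ^ l := by positivity
    split_ifs with h
    · rw [pow_succ] at h ⊢
      constructor <;> linarith [ih.2]
    · rw [pow_succ]
      constructor <;> linarith [ih.1, ih.2]

open Classical in
theorem abs_rescaledHaar_detail {l : ℕ} (d : DetailIndex l) (q : Pixel l) :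
    |rescaledHaar l (some d) q| = if d.Covers q then 2 ^ d.level / 4 else 0 := by
  rw [rescaledHaar, Matrix.diagonal_mul, abs_mul, abs_of_pos (haarScale_pos _)]
  simp only [haarMatrix, haarScale]
  split_ifs
  · rw [abs_mul, d.abs_sign, one_mul, abs_of_pos (by positivity),
      show (4 : ℝ) ^ d.level = 2 ^ d.level * 2 ^ d.level by rw [← mul_pow]; norm_num]
    field_simp
  · simp

/-- A unit mass at `q` has Haar coefficients off the tree around `P` only at the levels whose cells
are small compared to the distance from `q` to `P`; their sum is geometric. The hypothesis `hdist`
says that `D` is at least this distance. -/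
theorem sum_compl_nearTree_le {l : ℕ} (k : ℕ)
    (P : Finset (Pixel l)) (q : Pixel l) (D : ℝ)
    (hD : 0 ≤ D) (hdist : ∀ r, (∀ p ∈ P, r ≤ pixelDist p q) → r ≤ D) :
    ∑ v ∈ (nearTree k P)ᶜ, |rescaledHaar l v q| ≤ D := by
  classical
  have hroot := (isRootedSubtree_nearTree k P).1
  have e1 : ∑ v ∈ (nearTree k P)ᶜ, |rescaledHaar l v q| =
      ∑ v, if v ∈ nearTree k P then 0 else |rescaledHaar l v q| := by
    rw [← Finset.sum_add_sum_compl (nearTree k P)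
      (fun v => if v ∈ nearTree k P then 0 else |rescaledHaar l v q|),
      Finset.sum_eq_zero (s := nearTree k P) fun v hv => if_pos hv, zero_add]
    exact Finset.sum_congr rfl fun v hv => (if_neg (Finset.mem_compl.1 hv)).symm
  have e2 : ∀ d : DetailIndex l, (if some d ∈ nearTree k P then 0 else |rescaledHaar l (some d) q|)
      = if d.Covers q then (if some d ∈ nearTree k P then 0 else (2 : ℝ) ^ d.level / 4) else 0 := by
    intro d
    rw [abs_rescaledHaar_detail]
    split_ifs <;> rfl
  rw [e1, Fintype.sum_option, if_pos hroot, zero_add, Finset.sum_congr rfl fun d _ => e2 d,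
    sum_ite_covers q fun d => if some d ∈ nearTree k P then 0 else (2 : ℝ) ^ d.level / 4]
  have hlevel : ∀ j : Fin l, ∑ o : Fin 3, (if some (⟨j, cellAt j q, o⟩ : DetailIndex l) ∈
      nearTree k P then 0
        else (2 : ℝ) ^ (DetailIndex.level (⟨j, cellAt j q, o⟩ : DetailIndex l)) / 4) ≤
      3 / 4 * if 2 * (2 : ℝ) ^ (l - j.val) ≤ D then (2 : ℝ) ^ (l - j.val) else 0 := by
    intro j
    have hterm : ∀ o : Fin 3, (if some (⟨j, cellAt j q, o⟩ : DetailIndex l) ∈ nearTree k P then 0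
        else (2 : ℝ) ^ (DetailIndex.level (⟨j, cellAt j q, o⟩ : DetailIndex l)) / 4) ≤
        (if 2 * (2 : ℝ) ^ (l - j.val) ≤ D then (2 : ℝ) ^ (l - j.val) else 0) / 4 := by
      intro o
      by_cases hmem : some (⟨j, cellAt j q, o⟩ : DetailIndex l) ∈ nearTree k P
      · rw [if_pos hmem]
        split_ifs <;> positivity
      · rw [if_neg hmem, if_pos]
        · exact le_rfl
        · rw [some_mem_nearTree] at hmem
          push Not at hmem
          exact hdist _ fun p hp =>
            ((covers_mk_iff j _ o q).2 rfl).le_pixelDist (hmem.2 p hp)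
    calc _ ≤ ∑ _o : Fin 3,
          (if 2 * (2 : ℝ) ^ (l - j.val) ≤ D then (2 : ℝ) ^ (l - j.val) else 0) / 4 :=
          Finset.sum_le_sum fun o _ => hterm o
      _ = _ := by
        rw [Finset.sum_const, Finset.card_univ, Fintype.card_fin, nsmul_eq_mul]
        push_cast
        ring
  refine (Finset.sum_le_sum fun j _ => hlevel j).trans ?_
  rw [← Finset.mul_sum, Fin.sum_univ_eq_sum_range
    (fun j => if 2 * (2 : ℝ) ^ (l - j) ≤ D then (2 : ℝ) ^ (l - j) else 0) l]
  linarith [(sum_dyadic_le l D hD).1]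

/-- The distance of a pixel to a nonempty set of pixels. -/
noncomputable def setDist {l : ℕ} (P : Finset (Pixel l)) (hP : P.Nonempty) (q : Pixel l) : ℝ :=
  P.inf' hP fun p => pixelDist p q

theorem setDist_sub_le {l : ℕ} (P : Finset (Pixel l)) (hP : P.Nonempty) (q r : Pixel l) :
    setDist P hP q - setDist P hP r ≤ pixelDist q r := by
  obtain ⟨p, hp, hpr⟩ := P.exists_mem_eq_inf' hP fun p => pixelDist p r
  have h1 : setDist P hP q ≤ pixelDist p q := Finset.inf'_le _ hp
  have h2 : setDist P hP r = pixelDist p r := hpr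
  have h3 := pixelDist_triangle p r q
  rw [pixelDist_comm r q] at h3
  linarith

theorem setDist_nonneg {l : ℕ} (P : Finset (Pixel l)) (hP : P.Nonempty) (q : Pixel l) :
    0 ≤ setDist P hP q :=
  Finset.le_inf' _ _ fun p _ => pixelDist_nonneg p q

theorem setDist_le {l : ℕ} (P : Finset (Pixel l)) (hP : P.Nonempty) (q : Pixel l) :
    setDist P hP q ≤ 2 * 2 ^ l := by
  obtain ⟨p, hp⟩ := hP
  exact (Finset.inf'_le _ hp).trans (pixelDist_le p q)

theorem setDist_eq_zero {l : ℕ} (P : Finset (Pixel l)) (hP : P.Nonempty) {q : Pixel l}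
    (hq : q ∈ P) : setDist P hP q = 0 :=
  le_antisymm ((Finset.inf'_le (fun p => pixelDist p q) hq).trans_eq (pixelDist_self q))
    (setDist_nonneg P hP q)

/-- For nonnegative images, sparse approximation in the Earth-Mover norm is no better than
tree-sparse approximation of the wavelet coefficients. The distance to the support of a sparse
approximation is a dual certificate for its error, and bounds the coefficients off the tree. -/
theorem treeError_le_sparseEmdError {l k K : ℕ} (hk : 1 ≤ k) (hkl : 2 * k < 4 ^ l)
    (hK : 227 * (k * Real.log ((4 : ℝ) ^ l / k)) ≤ K) (x : Pixel l → ℝ) (hx : 0 ≤ x) :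
    treeError K x ≤ sparseEmdError k x := by
  classical
  refine le_csInf ⟨_, 0, by simp [sparseVectors], rfl⟩ ?_
  rintro _ ⟨x', hx', rfl⟩
  obtain ⟨P, hP, hPk, hsupp⟩ : ∃ P : Finset (Pixel l), P.Nonempty ∧ P.card ≤ k ∧
      ∀ p, p ∉ P → x' p = 0 := by
    by_cases h0 : x' = 0
    -- the certificate needs a nonempty set of pixels
    · refine ⟨{(⟨0, by positivity⟩, ⟨0, by positivity⟩)}, Finset.singleton_nonempty _, by simpa,
        fun p _ => by rw [h0]; rfl⟩
    · refine ⟨(Set.toFinite (Function.support x')).toFinset, ?_, ?_, fun p hp => ?_⟩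
      · simpa [Set.Finite.toFinset_nonempty] using Function.support_nonempty_iff.2 h0
      · rw [← Set.ncard_eq_toFinset_card]
        exact hx'
      · simpa using hp
  have hS : nearTree k P ∈ rootedSubtrees l K := by
    refine mem_rootedSubtrees.2 ⟨isRootedSubtree_nearTree k P, ?_⟩
    have := (card_nearTree_le_log hk hkl P hPk).trans hK
    exact_mod_cast this
  rw [treeError_eq_modelError]
  refine (modelError_le _ hS).trans ?_
  calc ∑ v ∈ (nearTree k P)ᶜ, |(rescaledHaar l).mulVec x v|
      ≤ ∑ v ∈ (nearTree k P)ᶜ, ∑ q, |rescaledHaar l v q| * x q := by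
        refine Finset.sum_le_sum fun v _ => ?_
        rw [Matrix.mulVec, dotProduct]
        refine (Finset.abs_sum_le_sum_abs _ _).trans (Finset.sum_le_sum fun q _ => ?_)
        rw [abs_mul, abs_of_nonneg (hx q)]
    _ = ∑ q, (∑ v ∈ (nearTree k P)ᶜ, |rescaledHaar l v q|) * x q := by
        rw [Finset.sum_comm]
        exact Finset.sum_congr rfl fun q _ => (Finset.sum_mul _ _ _).symm
    _ ≤ ∑ q, setDist P hP q * x q := by
        refine Finset.sum_le_sum fun q _ => mul_le_mul_of_nonneg_right ?_ (hx q)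
        exact sum_compl_nearTree_le k P q _ (setDist_nonneg P hP q)
          fun r hr => Finset.le_inf' _ _ hr
    _ = ∑ q, setDist P hP q * (x - x') q := by
        refine Finset.sum_congr rfl fun q _ => ?_
        by_cases hq : q ∈ P
        · rw [setDist_eq_zero P hP hq, zero_mul, zero_mul]
        · rw [Pi.sub_apply, hsupp q hq, sub_zero]
    _ ≤ emdNorm (x - x') :=
        sum_mul_le_emdNorm _ (setDist_sub_le P hP)
          (fun q => (abs_of_nonneg (setDist_nonneg P hP q)).trans_le (setDist_le P hP q)) _

/-! ### The null space property and recovery -/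

theorem exists_top_subset {ι : Type*} [DecidableEq ι] (f : ι → ℝ) (T : Finset ι) (k : ℕ)
    (hk : k ≤ T.card) :
    ∃ T₁ ⊆ T, T₁.card = k ∧ ∀ i ∈ T₁, ∀ j ∈ T \ T₁, f j ≤ f i := by
  induction k with
  | zero => exact ⟨∅, Finset.empty_subset _, rfl, by simp⟩
  | succ k ih =>
    obtain ⟨T₁, hT₁, hcard, htop⟩ := ih (by omega)
    have hne : (T \ T₁).Nonempty := by
      rw [← Finset.card_pos, Finset.card_sdiff_of_subset hT₁]
      omega
    obtain ⟨a, ha, hmax⟩ := Finset.exists_max_image (T \ T₁) f hne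
    obtain ⟨haT, haT₁⟩ := Finset.mem_sdiff.1 ha
    refine ⟨insert a T₁, Finset.insert_subset haT hT₁,
      by rw [Finset.card_insert_of_notMem haT₁, hcard], fun i hi j hj => ?_⟩
    have hj' : j ∈ T \ T₁ := by
      simp only [Finset.mem_sdiff, Finset.mem_insert, not_or] at hj ⊢
      exact ⟨hj.1, hj.2.2⟩
    rcases Finset.mem_insert.1 hi with rfl | hi
    · exact hmax j hj'
    · exact htop i hi j hj'

theorem norm_toLp_le_of_card_le {ι : Type*} [Fintype ι] (u : ι → ℝ) (T : Finset ι)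
    (hu : ∀ i, i ∉ T → u i = 0) (k : ℕ) (hT : T.card ≤ k) (τ : ℝ) (hτ : ∀ i, |u i| ≤ τ)
    (hτ0 : 0 ≤ τ) : ‖(WithLp.toLp 2 u : EuclideanSpace ℝ ι)‖ ≤ √k * τ := by
  apply le_of_sq_le_sq _ (by positivity)
  rw [EuclideanSpace.norm_sq_eq, mul_pow, Real.sq_sqrt (Nat.cast_nonneg k)]
  calc ∑ i, ‖u i‖ ^ 2 = ∑ i ∈ T, ‖u i‖ ^ 2 := by
        refine (Finset.sum_subset (Finset.subset_univ T) fun i _ hi => ?_).symm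
        simp [hu i hi]
    _ ≤ ∑ _i ∈ T, τ ^ 2 := Finset.sum_le_sum fun i _ => by
        rw [Real.norm_eq_abs]
        exact pow_le_pow_left₀ (abs_nonneg _) (hτ i) 2
    _ = T.card * τ ^ 2 := by simp
    _ ≤ k * τ ^ 2 := by gcongr

/-- A subadditive functional that is bounded on `k`-sparse vectors by their Euclidean norm is
bounded on all vectors: split off the `k` largest entries one block at a time. The sup norm of
the next block is at most the average modulus in the current block. -/
theorem subadditive_le_of_sparse_bound {ι : Type*} [Fintype ι] [DecidableEq ι]
    (N : (ι → ℝ) → ℝ) (hadd : ∀ u w, N (u + w) ≤ N u + N w) (β : ℝ) (hβ : 0 ≤ β) (k : ℕ)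
    (hk : 1 ≤ k)
    (hN : ∀ T : Finset ι, T.card ≤ k → ∀ u : ι → ℝ, (∀ i, i ∉ T → u i = 0) →
      N u ≤ β * ‖(WithLp.toLp 2 u : EuclideanSpace ℝ ι)‖)
    (T : Finset ι) (u : ι → ℝ) (hu : ∀ i, i ∉ T → u i = 0) (τ : ℝ) (hτ : ∀ i, |u i| ≤ τ)
    (hτ0 : 0 ≤ τ) : N u ≤ β * (√k * (τ + (∑ i ∈ T, |u i|) / k)) := by
  have hk0 : (0 : ℝ) < k := by exact_mod_cast hk
  induction hn : T.card using Nat.strong_induction_on generalizing T u τ with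
  | _ n ih =>
    by_cases hTk : T.card ≤ k
    · have h1 := hN T hTk u hu
      have h2 := norm_toLp_le_of_card_le u T hu k hTk τ hτ hτ0
      have h3 : 0 ≤ (∑ i ∈ T, |u i|) / k :=
        div_nonneg (Finset.sum_nonneg fun _ _ => abs_nonneg _) hk0.le
      refine h1.trans (mul_le_mul_of_nonneg_left (h2.trans ?_) hβ)
      gcongr
      linarith
    · obtain ⟨T₁, hT₁, hcard, htop⟩ := exists_top_subset (fun i => |u i|) T k (by omega)
      have hne : T₁.Nonempty := Finset.card_pos.1 (by omega)
      obtain ⟨a, ha, hmin⟩ := Finset.exists_min_image T₁ (fun i => |u i|) hne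
      set u₁ : ι → ℝ := fun i => if i ∈ T₁ then u i else 0 with hu₁
      set u₂ : ι → ℝ := fun i => if i ∈ T \ T₁ then u i else 0 with hu₂
      have hsplit : u = u₁ + u₂ := by
        funext i
        simp only [hu₁, hu₂, Pi.add_apply, Finset.mem_sdiff]
        by_cases h1 : i ∈ T₁
        · simp [h1]
        · by_cases h2 : i ∈ T
          · simp [h1, h2]
          · simp [h1, h2, hu i h2]
      have hb₁ : N u₁ ≤ β * (√k * τ) := by
        have hz : ∀ i, i ∉ T₁ → u₁ i = 0 := fun i hi => if_neg hi
        refine (hN T₁ hcard.le u₁ hz).trans (mul_le_mul_of_nonneg_left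
          (norm_toLp_le_of_card_le u₁ T₁ hz k hcard.le τ (fun i => ?_) hτ0) hβ)
        simp only [hu₁]
        split_ifs
        · exact hτ i
        · simpa using hτ0
      have hb₂ := ih (T \ T₁).card (by rw [Finset.card_sdiff_of_subset hT₁]; omega) (T \ T₁) u₂
        (fun i hi => if_neg hi) |u a| (fun i => by
          simp only [hu₂]
          split_ifs with hi
          · exact htop a ha i hi
          · simp) (abs_nonneg _) rfl
      have hsum₂ : ∑ i ∈ T \ T₁, |u₂ i| = ∑ i ∈ T \ T₁, |u i| :=
        Finset.sum_congr rfl fun i hi => by simp only [hu₂, if_pos hi]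
      have hsum₁ : k * |u a| ≤ ∑ i ∈ T₁, |u i| := by
        have := Finset.card_nsmul_le_sum T₁ (fun i => |u i|) |u a| hmin
        rwa [hcard, nsmul_eq_mul] at this
      have hsum : ∑ i ∈ T \ T₁, |u i| + ∑ i ∈ T₁, |u i| = ∑ i ∈ T, |u i| :=
        Finset.sum_sdiff hT₁
      have htail : |u a| + (∑ i ∈ T \ T₁, |u i|) / k ≤ (∑ i ∈ T, |u i|) / k := by
        rw [← hsum, add_div]
        have : |u a| ≤ (∑ i ∈ T₁, |u i|) / k := by
          rw [le_div_iff₀ hk0]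
          linarith
        linarith
      rw [hsum₂] at hb₂
      calc N u ≤ N u₁ + N u₂ := by
            rw [hsplit]
            exact hadd u₁ u₂
        _ ≤ β * (√k * τ) + β * (√k * (|u a| + (∑ i ∈ T \ T₁, |u i|) / k)) := add_le_add hb₁ hb₂
        _ ≤ β * (√k * τ) + β * (√k * ((∑ i ∈ T, |u i|) / k)) := by gcongr
        _ = β * (√k * (τ + (∑ i ∈ T, |u i|) / k)) := by ring

/-- The Euclidean norm of the image of a coefficient vector under a matrix. -/
noncomputable def imageNorm {ι : Type*} [Fintype ι] [DecidableEq ι] {m : ℕ}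
    (B : Matrix (Fin m) ι ℝ) (u : ι → ℝ) : ℝ :=
  ‖Matrix.toEuclideanLin B (WithLp.toLp 2 u)‖

theorem imageNorm_add_le {ι : Type*} [Fintype ι] [DecidableEq ι] {m : ℕ}
    (B : Matrix (Fin m) ι ℝ) (u w : ι → ℝ) :
    imageNorm B (u + w) ≤ imageNorm B u + imageNorm B w := by
  unfold imageNorm
  rw [WithLp.toLp_add, map_add]
  exact norm_add_le _ _

theorem imageNorm_neg {ι : Type*} [Fintype ι] [DecidableEq ι] {m : ℕ}
    (B : Matrix (Fin m) ι ℝ) (u : ι → ℝ) : imageNorm B (-u) = imageNorm B u := by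
  unfold imageNorm
  rw [WithLp.toLp_neg, map_neg, norm_neg]

theorem imageNorm_eq_zero {ι : Type*} [Fintype ι] [DecidableEq ι] {m : ℕ}
    (B : Matrix (Fin m) ι ℝ) (u : ι → ℝ) (hu : B.mulVec u = 0) : imageNorm B u = 0 := by
  unfold imageNorm
  have : Matrix.toEuclideanLin B (WithLp.toLp 2 u) = WithLp.toLp 2 (B.mulVec u) := rfl
  rw [this, hu, WithLp.toLp_zero, norm_zero]

/-- The restricted isometry property for the tree-sparse model, with constants `1 / 8` and `2`. -/
def ModelRIP {l m : ℕ} (D : ℕ) (B : Matrix (Fin m) (WaveletIndex l) ℝ) : Prop :=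
  ∀ S ∈ rootedSubtrees l D, ∀ u : WaveletIndex l → ℝ, (∀ i, i ∉ S → u i = 0) →
    ‖(WithLp.toLp 2 u : EuclideanSpace ℝ (WaveletIndex l))‖ / 8 ≤ imageNorm B u ∧
      imageNorm B u ≤ 2 * ‖(WithLp.toLp 2 u : EuclideanSpace ℝ (WaveletIndex l))‖

theorem exists_modelRIP (l D : ℕ) (hD : 1 ≤ D) :
    ∃ B : Matrix (Fin (640 * D)) (WaveletIndex l) ℝ, ModelRIP D B := by
  obtain ⟨B, hB⟩ := exists_matrix_norm_bounds
    (κ := {S : Finset (WaveletIndex l) // S ∈ rootedSubtrees l D})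
    (fun S => Submodule.span ℝ ((S.1.image fun i => EuclideanSpace.single i (1 : ℝ) :
      Finset (EuclideanSpace ℝ (WaveletIndex l))) : Set (EuclideanSpace ℝ (WaveletIndex l))))
    D hD (by rw [Fintype.card_coe]; exact card_rootedSubtrees_le l D)
    (fun S => (finrank_span_finset_le_card _).trans
      (Finset.card_image_le.trans (mem_rootedSubtrees.1 S.2).2))
  refine ⟨B, fun S hS u hu => hB ⟨S, hS⟩ _ ?_⟩
  have e : (WithLp.toLp 2 u : EuclideanSpace ℝ (WaveletIndex l)) =
      ∑ i ∈ S, u i • EuclideanSpace.single i (1 : ℝ) := by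
    ext j
    by_cases hj : j ∈ S
    · simp [Finset.sum_apply, Pi.single_apply, hj]
    · simp [Finset.sum_apply, Pi.single_apply, hj, hu j hj]
  rw [e]
  exact Submodule.sum_mem _ fun i hi => Submodule.smul_mem _ _
    (Submodule.subset_span (Finset.mem_coe.2 (Finset.mem_image_of_mem _ hi)))

theorem rootedSubtrees_mono {l K K' : ℕ} (h : K ≤ K') : rootedSubtrees l K ⊆ rootedSubtrees l K' :=
  fun S hS => by
    rw [mem_rootedSubtrees] at hS ⊢
    exact ⟨hS.1, hS.2.trans h⟩

theorem DetailIndex.covers_corner {l : ℕ} (d : DetailIndex l) : d.Covers d.corner :=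
  ⟨Nat.mul_div_cancel _ (by positivity), Nat.mul_div_cancel _ (by positivity)⟩

/-- Any `k` vertices of the wavelet tree lie in a rooted subtree with `O(k log (n / k))`
vertices. -/
theorem exists_rootedSubtree_superset {l k K : ℕ} (hk : 1 ≤ k) (hkl : 2 * k < 4 ^ l)
    (hK : 227 * (k * Real.log ((4 : ℝ) ^ l / k)) ≤ K) (Q : Finset (WaveletIndex l))
    (hQ : Q.card ≤ k) : ∃ S ∈ rootedSubtrees l K, Q ⊆ S := by
  classical
  set P : Finset (Pixel l) :=
    Q.image fun v => v.elim (⟨0, by positivity⟩, ⟨0, by positivity⟩) DetailIndex.corner with hP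
  have hPk : P.card ≤ k := Finset.card_image_le.trans hQ
  refine ⟨nearTree k P, mem_rootedSubtrees.2 ⟨isRootedSubtree_nearTree k P, ?_⟩, fun v hv => ?_⟩
  · exact_mod_cast (card_nearTree_le_log hk hkl P hPk).trans hK
  · cases v with
    | none => exact (isRootedSubtree_nearTree k P).1
    | some d =>
      exact some_mem_nearTree.2 (Or.inr ⟨d.corner, Finset.mem_image.2 ⟨some d, hv, rfl⟩,
        d.covers_corner.near⟩)

theorem sum_abs_le_sqrt_card_mul {ι : Type*} [Fintype ι] (u : ι → ℝ) (S : Finset ι) :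
    ∑ i ∈ S, |u i| ≤ √S.card * ‖(WithLp.toLp 2 u : EuclideanSpace ℝ ι)‖ := by
  have h := sq_sum_le_card_mul_sum_sq (s := S) (f := fun i => |u i|)
  have h2 : ∑ i ∈ S, |u i| ^ 2 ≤ ‖(WithLp.toLp 2 u : EuclideanSpace ℝ ι)‖ ^ 2 := by
    rw [EuclideanSpace.norm_sq_eq]
    exact Finset.sum_le_sum_of_subset_of_nonneg (Finset.subset_univ _) fun _ _ _ => sq_nonneg _
  apply le_of_sq_le_sq _ (by positivity)
  rw [mul_pow, Real.sq_sqrt (Nat.cast_nonneg _)]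
  exact h.trans (mul_le_mul_of_nonneg_left h2 (Nat.cast_nonneg _))

/-- The null space property. The tree `S` is enlarged to a tree `S'` that also contains the at most
`k` entries off `S` that exceed `t / k`, where `t` is the `ℓ₁` norm off `S`. What remains off `S'`
is flat, so its image has norm `O(t / √k)`, and this controls the part on `S'` in `ℓ₂`. Only the
passage from `ℓ₂` to `ℓ₁` on `S'` costs a factor `√(K / k)`. -/
theorem ModelRIP.l1Norm_le {l m k K : ℕ} (hk : 1 ≤ k) (hkl : 2 * k < 4 ^ l)
    (hK : 227 * (k * Real.log ((4 : ℝ) ^ l / k)) ≤ K) {B : Matrix (Fin m) (WaveletIndex l) ℝ}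
    (hB : ModelRIP (3 * K) B) (h : WaveletIndex l → ℝ) (hh : B.mulVec h = 0)
    (S : Finset (WaveletIndex l)) (hS : S ∈ rootedSubtrees l (2 * K)) :
    l1Norm h ≤ (1 + 32 * √(3 * K / k)) * ∑ i ∈ Sᶜ, |h i| := by
  have hk0 : (0 : ℝ) < k := by exact_mod_cast hk
  set t := ∑ i ∈ Sᶜ, |h i| with ht
  have ht0 : 0 ≤ t := Finset.sum_nonneg fun _ _ => abs_nonneg _
  set Q := Sᶜ.filter fun i => t / k < |h i| with hQdef
  -- more than `k` entries exceeding `t / k` would have total modulus more than `t`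
  have hQ : Q.card ≤ k := by
    by_contra! hlt
    have h1 : ∑ _i ∈ Q, t / k < ∑ i ∈ Q, |h i| := by
      refine Finset.sum_lt_sum_of_nonempty (Finset.card_pos.1 (by omega)) fun i hi => ?_
      exact (Finset.mem_filter.1 hi).2
    have h2 : ∑ i ∈ Q, |h i| ≤ t :=
      Finset.sum_le_sum_of_subset_of_nonneg (Finset.filter_subset _ _) fun _ _ _ => abs_nonneg _
    have h3 : t ≤ ∑ _i ∈ Q, t / k := by
      rw [Finset.sum_const, nsmul_eq_mul]
      have : (k : ℝ) ≤ Q.card := by exact_mod_cast hlt.le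
      calc t = k * (t / k) := by field_simp
        _ ≤ Q.card * (t / k) := by gcongr
    linarith
  obtain ⟨S₁, hS₁, hQS₁⟩ := exists_rootedSubtree_superset hk hkl hK Q hQ
  set S' := S ∪ S₁ with hS'def
  have hS' : S' ∈ rootedSubtrees l (3 * K) := by
    rw [mem_rootedSubtrees] at hS hS₁ ⊢
    have := Finset.card_union_le S S₁
    rw [← hS'def] at this
    exact ⟨hS.1.union hS₁.1, by omega⟩
  set u₁ : WaveletIndex l → ℝ := fun i => if i ∈ S' then h i else 0 with hu₁
  set u₂ : WaveletIndex l → ℝ := fun i => if i ∈ S'ᶜ then h i else 0 with hu₂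
  have hsplit : h = u₁ + u₂ := by
    funext i
    by_cases hi : i ∈ S' <;> simp [hu₁, hu₂, hi]
  have htail : ∑ i ∈ S'ᶜ, |h i| ≤ t :=
    Finset.sum_le_sum_of_subset_of_nonneg
      (Finset.compl_subset_compl.2 Finset.subset_union_left) fun _ _ _ => abs_nonneg _
  have hflat : ∀ i, |u₂ i| ≤ t / k := by
    intro i
    simp only [hu₂]
    split_ifs with hi
    · by_contra! hcon
      rw [Finset.mem_compl, hS'def, Finset.mem_union, not_or] at hi
      exact hi.2 (hQS₁ (Finset.mem_filter.2 ⟨Finset.mem_compl.2 hi.1, hcon⟩))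
    · rw [abs_zero]
      positivity
  have hsum₂ : ∑ i ∈ S'ᶜ, |u₂ i| = ∑ i ∈ S'ᶜ, |h i| :=
    Finset.sum_congr rfl fun i hi => by simp only [hu₂, if_pos hi]
  have himage₂ : imageNorm B u₂ ≤ 2 * (√k * (t / k + t / k)) := by
    refine (subadditive_le_of_sparse_bound (imageNorm B) (imageNorm_add_le B) 2 (by norm_num) k hk
      (fun T hT u hu => ?_) S'ᶜ u₂ (fun i hi => if_neg hi) (t / k) hflat (by positivity)).trans ?_
    · obtain ⟨S₂, hS₂, hTS₂⟩ := exists_rootedSubtree_superset hk hkl hK T hT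
      exact (hB S₂ (rootedSubtrees_mono (by omega) hS₂) u
        fun i hi => hu i fun hiT => hi (hTS₂ hiT)).2
    · rw [hsum₂]
      gcongr
  have himage₁ : imageNorm B u₁ ≤ imageNorm B u₂ := by
    have e : u₁ = h + -u₂ := by
      rw [hsplit]
      abel
    rw [e]
    refine (imageNorm_add_le B _ _).trans_eq ?_
    rw [imageNorm_eq_zero B h hh, imageNorm_neg, zero_add]
  have hnorm₁ : ‖(WithLp.toLp 2 u₁ : EuclideanSpace ℝ (WaveletIndex l))‖ ≤ 32 * (√k * (t / k)) := by
    have := (hB S' hS' u₁ fun i hi => if_neg hi).1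
    linarith
  have hsum₁ : ∑ i ∈ S', |h i| ≤ 32 * √(3 * K / k) * t := by
    have e : ∑ i ∈ S', |h i| = ∑ i ∈ S', |u₁ i| :=
      Finset.sum_congr rfl fun i hi => by simp only [hu₁, if_pos hi]
    have hcard : √(S'.card : ℝ) ≤ √(3 * K) := by
      apply Real.sqrt_le_sqrt
      exact_mod_cast (mem_rootedSubtrees.1 hS').2
    have hsq : √(k : ℝ) * √k = k := Real.mul_self_sqrt hk0.le
    have hsk : 0 < √(k : ℝ) := Real.sqrt_pos.2 hk0
    calc ∑ i ∈ S', |h i| ≤ √S'.card * ‖(WithLp.toLp 2 u₁ : EuclideanSpace ℝ (WaveletIndex l))‖ :=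
          e.trans_le (sum_abs_le_sqrt_card_mul u₁ S')
      _ ≤ √(3 * K) * (32 * (√k * (t / k))) := by gcongr
      _ = 32 * √(3 * K / k) * t := by
        rw [Real.sqrt_div (by positivity)]
        field_simp
        rw [sq, hsq]
        ring
  have htotal : l1Norm h = ∑ i ∈ S', |h i| + ∑ i ∈ S'ᶜ, |h i| :=
    (Finset.sum_add_sum_compl S' fun i => |h i|).symm
  rw [htotal]
  linarith

theorem modelError_le_add {l K : ℕ} (hK : 1 ≤ K) (v w : WaveletIndex l → ℝ) :
    modelError K v ≤ modelError K w + l1Norm (v - w) := by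
  obtain ⟨S, hS, hw⟩ := exists_modelError_eq hK w
  have h : ∑ i ∈ Sᶜ, |v i| ≤ ∑ i ∈ Sᶜ, |w i| + ∑ i ∈ Sᶜ, |(v - w) i| := by
    rw [← Finset.sum_add_distrib]
    refine Finset.sum_le_sum fun i _ => ?_
    have := abs_add_le (w i) ((v - w) i)
    simpa using this
  have h' : ∑ i ∈ Sᶜ, |(v - w) i| ≤ l1Norm (v - w) :=
    Finset.sum_le_sum_of_subset_of_nonneg (Finset.subset_univ _) fun _ _ _ => abs_nonneg _
  linarith [modelError_le v hS]

theorem continuous_modelError {l K : ℕ} (hK : 1 ≤ K) :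
    Continuous (modelError K : (WaveletIndex l → ℝ) → ℝ) := by
  refine (LipschitzWith.of_le_add_mul (Fintype.card (WaveletIndex l) : NNReal)
    fun v w => (modelError_le_add hK v w).trans ?_).continuous
  gcongr
  unfold l1Norm
  calc ∑ i, |(v - w) i| ≤ ∑ _i : WaveletIndex l, dist v w :=
        Finset.sum_le_sum fun i _ => by
          rw [Pi.sub_apply, ← Real.dist_eq]
          exact dist_le_pi_dist v w i
    _ = _ := by simp

theorem dist_le_l1Norm {ι : Type*} [Fintype ι] (v w : ι → ℝ) : dist v w ≤ l1Norm (v - w) := by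
  refine (dist_pi_le_iff (l1Norm_nonneg _)).2 fun i => ?_
  rw [Real.dist_eq]
  exact Finset.single_le_sum (f := fun i => |(v - w) i|) (fun _ _ => abs_nonneg _)
    (Finset.mem_univ i)

/-- Two coefficient vectors with the same sketch differ by at most the sum of their errors: the
union of their optimal trees is a tree of at most `2 * K` vertices. -/
theorem ModelRIP.l1Norm_sub_le {l m k K : ℕ} (hk : 1 ≤ k) (hkl : 2 * k < 4 ^ l)
    (hK : 227 * (k * Real.log ((4 : ℝ) ^ l / k)) ≤ K) (hK1 : 1 ≤ K)
    {B : Matrix (Fin m) (WaveletIndex l) ℝ} (hB : ModelRIP (3 * K) B)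
    (v w : WaveletIndex l → ℝ) (hvw : B.mulVec v = B.mulVec w) :
    l1Norm (v - w) ≤ (1 + 32 * √(3 * K / k)) * (modelError K v + modelError K w) := by
  obtain ⟨S, hS, hv⟩ := exists_modelError_eq hK1 v
  obtain ⟨T, hT, hw⟩ := exists_modelError_eq hK1 w
  have hST : S ∪ T ∈ rootedSubtrees l (2 * K) := by
    rw [mem_rootedSubtrees] at hS hT ⊢
    have := Finset.card_union_le S T
    exact ⟨hS.1.union hT.1, by omega⟩
  refine (hB.l1Norm_le hk hkl hK (v - w) (by rw [Matrix.mulVec_sub, hvw, sub_self]) _ hST).trans ?_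
  gcongr
  have h1 : ∑ i ∈ (S ∪ T)ᶜ, |v i| ≤ ∑ i ∈ Sᶜ, |v i| :=
    Finset.sum_le_sum_of_subset_of_nonneg
      (Finset.compl_subset_compl.2 Finset.subset_union_left) fun _ _ _ => abs_nonneg _
  have h2 : ∑ i ∈ (S ∪ T)ᶜ, |w i| ≤ ∑ i ∈ Tᶜ, |w i| :=
    Finset.sum_le_sum_of_subset_of_nonneg
      (Finset.compl_subset_compl.2 Finset.subset_union_right) fun _ _ _ => abs_nonneg _
  have h3 : ∑ i ∈ (S ∪ T)ᶜ, |(v - w) i| ≤ ∑ i ∈ (S ∪ T)ᶜ, |v i| + ∑ i ∈ (S ∪ T)ᶜ, |w i| := by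
    rw [← Finset.sum_add_distrib]
    exact Finset.sum_le_sum fun i _ => abs_sub _ _
  linarith

/-- Recovery by minimizing the model error over all coefficient vectors with the given sketch. The
minimum is attained, because the sublevel sets are compact. -/
theorem ModelRIP.exists_recovery {l m k K : ℕ} (hk : 1 ≤ k) (hkl : 2 * k < 4 ^ l)
    (hK : 227 * (k * Real.log ((4 : ℝ) ^ l / k)) ≤ K) (hK1 : 1 ≤ K)
    {B : Matrix (Fin m) (WaveletIndex l) ℝ} (hB : ModelRIP (3 * K) B) :
    ∃ R : (Fin m → ℝ) → (WaveletIndex l → ℝ), ∀ v,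
      l1Norm (R (B.mulVec v) - v) ≤ 2 * (1 + 32 * √(3 * K / k)) * modelError K v := by
  set C := 1 + 32 * √(3 * K / k : ℝ) with hC
  have hC0 : 0 ≤ C := by positivity
  have hmin : ∀ y : Fin m → ℝ, ∃ r : WaveletIndex l → ℝ, ∀ v, B.mulVec v = y →
      B.mulVec r = y ∧ modelError K r ≤ modelError K v := by
    intro y
    by_cases hy : ∃ v₀, B.mulVec v₀ = y
    · obtain ⟨v₀, hv₀⟩ := hy
      set Z : Set (WaveletIndex l → ℝ) := {v | B.mulVec v = y ∧ modelError K v ≤ modelError K v₀}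
        with hZ
      have hclosed : IsClosed Z :=
        (isClosed_eq (continuous_const.matrix_mulVec continuous_id) continuous_const).inter
          (isClosed_le (continuous_modelError hK1) continuous_const)
      have hbounded : Bornology.IsBounded Z := by
        refine (Metric.isBounded_closedBall (x := v₀)
          (r := C * (modelError K v₀ + modelError K v₀))).subset fun v hv => ?_
        refine Metric.mem_closedBall.2 ((dist_le_l1Norm v v₀).trans
          ((hB.l1Norm_sub_le hk hkl hK hK1 v v₀ (hv.1.trans hv₀.symm)).trans ?_))
        exact mul_le_mul_of_nonneg_left (by linarith [hv.2]) hC0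
      obtain ⟨r, hr, hrmin⟩ := (Metric.isCompact_of_isClosed_isBounded hclosed
        hbounded).exists_isMinOn ⟨v₀, hv₀, le_rfl⟩ (continuous_modelError hK1).continuousOn
      refine ⟨r, fun v hv => ⟨hr.1, ?_⟩⟩
      rcases le_total (modelError K v) (modelError K v₀) with h | h
      · exact hrmin ⟨hv, h⟩
      · exact hr.2.trans h
    · exact ⟨0, fun v hv => absurd ⟨v, hv⟩ hy⟩
  choose R hR using hmin
  refine ⟨R, fun v => ?_⟩
  obtain ⟨h1, h2⟩ := hR (B.mulVec v) v rfl
  refine (hB.l1Norm_sub_le hk hkl hK hK1 _ v h1).trans ?_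
  rw [mul_comm 2, mul_assoc]
  exact mul_le_mul_of_nonneg_left (by linarith) hC0

/-! ### Tree-sparse recovery in the Earth-Mover norm -/

theorem mainTheorem6 :
    ∃ c c₁ C₀ : ℝ, 0 < c ∧ 0 < c₁ ∧ 0 < C₀ ∧
      ∀ l k : ℕ, 1 ≤ k → 2 * k < 4 ^ l →
        ∀ K : ℕ, K = ⌈c * (k * Real.log ((4 : ℝ) ^ l / k))⌉₊ →
          ∃ (m : ℕ) (C : ℝ) (A : Matrix (Fin m) (Pixel l) ℝ)
            (recover : (Fin m → ℝ) → (Pixel l → ℝ)),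
            (m : ℝ) ≤ c₁ * (k * Real.log ((4 : ℝ) ^ l / k)) ∧
            0 < C ∧ C ≤ C₀ * √(Real.log ((4 : ℝ) ^ l / k)) ∧
            (∀ x : Pixel l → ℝ,
              emdNorm (recover (A.mulVec x) - x) ≤ C * treeError K x) ∧
            (∀ x : Pixel l → ℝ, 0 ≤ x →
              C * treeError K x ≤ C * sparseEmdError k x) := by
  -- `439680 = 640 * 3 * 229` counts rows, and `13856 = 8 * 2 * 866`, where `866 √L` bounds the
  -- constant of the null space property
  refine ⟨227, 439680, 13856, by norm_num, by norm_num, by norm_num, fun l k hk hkl K hK => ?_⟩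
  have hk0 : (0 : ℝ) < k := by exact_mod_cast hk
  set L := Real.log ((4 : ℝ) ^ l / k) with hL
  have hLhalf : 1 / 2 ≤ L := half_le_log_ratio hk hkl
  have hkL : 1 / 2 ≤ k * L := by
    have : (1 : ℝ) ≤ k := by exact_mod_cast hk
    nlinarith
  have hKlow : 227 * (k * L) ≤ K := hK ▸ Nat.le_ceil _
  have hKup : (K : ℝ) ≤ 229 * (k * L) := by
    have := Nat.ceil_lt_add_one (a := 227 * (k * L)) (by linarith)
    rw [← hK] at this
    linarith
  have hK1 : 1 ≤ K := by
    have : (0 : ℝ) < K := by linarith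
    exact_mod_cast this
  obtain ⟨B, hB⟩ := exists_modelRIP l (3 * K) (by omega)
  obtain ⟨R, hR⟩ := hB.exists_recovery hk hkl hKlow hK1
  have hsqrtL : 0 < √L := Real.sqrt_pos.2 (by linarith)
  refine ⟨640 * (3 * K), 13856 * √L, B * rescaledHaar l, fun y => haarSynth (R y), ?_,
    by positivity, le_rfl, fun x => ?_, fun x hx => ?_⟩
  · push_cast
    linarith
  · have hnonneg : 0 ≤ treeError K x :=
      Real.sInf_nonneg (by rintro _ ⟨y, -, rfl⟩; exact l1Norm_nonneg _)
    have hconst : 1 + 32 * √(3 * K / k) ≤ 866 * √L := by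
      have h1 : 1 ≤ 2 * √L := by
        have : (1 / 2) ^ 2 ≤ L := by linarith
        linarith [Real.le_sqrt_of_sq_le this]
      have h2 : √(3 * K / k) ≤ 27 * √L := by
        rw [Real.sqrt_le_left (by positivity), mul_pow, Real.sq_sqrt (by linarith),
          div_le_iff₀ hk0]
        nlinarith
      linarith
    set v := (rescaledHaar l).mulVec x with hv
    calc emdNorm (haarSynth (R ((B * rescaledHaar l).mulVec x)) - x)
        = emdNorm (haarSynth (R (B.mulVec v) - v)) := by
          rw [haarSynth_sub, hv, haarSynth_rescaledHaar, Matrix.mulVec_mulVec]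
      _ ≤ 8 * l1Norm (R (B.mulVec v) - v) := emdNorm_haarSynth_le _
      _ ≤ 8 * (2 * (1 + 32 * √(3 * K / k)) * modelError K v) := by gcongr; exact hR v
      _ = 16 * (1 + 32 * √(3 * K / k)) * treeError K x := by
          rw [treeError_eq_modelError]
          ring
      _ ≤ 16 * (866 * √L) * treeError K x := by gcongr
      _ = 13856 * √L * treeError K x := by ring
  · exact mul_le_mul_of_nonneg_left (treeError_le_sparseEmdError hk hkl hKlow x hx) (by positivity)
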